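/- Let $\mathbb{K}$ be an algebraically closed field of characteristic zero, $R=\mathbb{K}[x_0,\dots,x_n]$ and $Q=\mathbb{K}[X_0,\dots,X_n]$, where $Q$ acts on $R$ by $X_i=\partial/\partial x_i$. Let $0\neq f\in R_d$ be a form of degree $d$, $I=\mathrm{Ann}_f=\{\alpha\in Q:\alpha(f)=0\}$, and let $A=Q/I=\bigoplus_k A_k$ be the associated standard graded Artinian Gorenstein algebra of socle degree $d$; put $h_k=\dim_{\mathbb{K}}A_k$. For each $k$ fix a basis $\alpha_1,\dots,\alpha_{h_k}$ of $A_k$ and let $\mathrm{hess}^k_f=\det\big(\alpha_i\alpha_j(f)\big)_{i,j}\in R$ be the $k$-th Hessian of $f$. Let $I^{-1}_k=\{g\in R_k:\alpha(g)=0\ \text{for all }\alpha\in I\}$ (this is the space of partial derivatives of $f$ of order $d-k$, and has dimension $h_k$), fix a basis $F_1,\dots,F_{h_k}$ of it, and let $X_k\subseteq\mathbb{P}^{h_k-1}$ be the closure of the image of the rational map $\varphi_k=(F_1:\dots:F_{h_k}):\mathbb{P}^n\dashrightarrow\mathbb{P}^{h_k-1}$ (the polar variety defined by forms of degree $k$).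 For a general point $x\in X_k$ let $T^s_xX_k\subseteq\mathbb{P}^{h_k-1}$ be the $s$-th osculating space, i.e. the linear space spanned by all partial derivatives of order $\le s$ of a local parametrization of $X_k$ at $x$ (equivalently, the smallest linear space containing the $s$-th infinitesimal neighbourhood of $x$ in $X_k$). We say that $T^sX_k$ has the expected dimension if, for a general point $x\in X_k$, $$\dim T^s_xX_k=\min\left\{\binom{n+s}{s}-1,\ h_k-1\right\}.$$ The algebra $A$ has the strong Lefschetz property (SLP) if there is $L\in A_1$ such that $\times L^{s-k}:A_k\to A_s$ has maximal rank for all $0\le k<s$. Then the following assertions are equivalent: 1. $A$ has the SLP; 2. $\mathrm{hess}^k_f\neq0$ for every integer $0\le k\le d/2$; 3. for every positive integer $k<d/2$, the osculating space $T^kX_{d-k}$ has the expected dimension. -/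

import Mathlib

open MvPolynomial
open scoped LinearAlgebra.Projectivization

noncomputable section

namespace Apolar

variable {K : Type*} [Field K] {n : ℕ}

/-- The partial derivative `∂/∂xᵢ` as a `K`-linear endomorphism of `R = K[x₀, …, xₙ]`. -/
def partialEnd (K : Type*) [Field K] {n : ℕ} (i : Fin (n + 1)) :
    Module.End K (MvPolynomial (Fin (n + 1)) K) :=
  ((pderiv i : Derivation K (MvPolynomial (Fin (n + 1)) K) (MvPolynomial (Fin (n + 1)) K)) :
    MvPolynomial (Fin (n + 1)) K →ₗ[K] MvPolynomial (Fin (n + 1)) K)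

theorem partialEnd_commute (i j : Fin (n + 1)) :
    Commute (partialEnd K i) (partialEnd K j) := by
  have h : ⁅(pderiv i : Derivation K (MvPolynomial (Fin (n + 1)) K)
      (MvPolynomial (Fin (n + 1)) K)),
      (pderiv j : Derivation K (MvPolynomial (Fin (n + 1)) K) (MvPolynomial (Fin (n + 1)) K))⁆ =
      0 := by
    apply MvPolynomial.derivation_ext
    intro k
    rw [Derivation.commutator_apply, pderiv_X, pderiv_X]
    simp only [Pi.single_apply]
    split_ifs <;> simp
  refine LinearMap.ext fun p => ?_
  have h2 := congrArg (fun D => D p) h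
  simp only [Derivation.commutator_apply, Derivation.zero_apply, sub_eq_zero] at h2
  exact h2

theorem partialEnd_pow_pairwise (m : Fin (n + 1) → ℕ) :
    ((Finset.univ : Finset (Fin (n + 1))) : Set (Fin (n + 1))).Pairwise
      (Function.onFun Commute fun i => partialEnd K i ^ m i) :=
  fun i _ j _ _ => (partialEnd_commute i j).pow_pow _ _

/-- The differential operator `∂^m = ∏ᵢ (∂/∂xᵢ)^(mᵢ)` of a multi-index `m`. -/
def monomialOp (K : Type*) [Field K] {n : ℕ} (m : Fin (n + 1) →₀ ℕ) :
    Module.End K (MvPolynomial (Fin (n + 1)) K) :=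
  Finset.univ.noncommProd (fun i => partialEnd K i ^ m i) (partialEnd_pow_pairwise m)

theorem monomialOp_zero : monomialOp K (0 : Fin (n + 1) →₀ ℕ) = 1 := by
  unfold monomialOp
  apply Finset.noncommProd_eq_pow_card _ _ _ 1 _ |>.trans (one_pow _)
  intro i _
  simp

theorem monomialOp_add (m m' : Fin (n + 1) →₀ ℕ) :
    monomialOp K (m + m') = monomialOp K m * monomialOp K m' := by
  have h := Finset.noncommProd_mul_distrib (s := Finset.univ)
    (fun i => partialEnd K i ^ m i) (fun i => partialEnd K i ^ m' i)
    (fun i _ j _ _ => (partialEnd_commute i j).pow_pow _ _)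
    (fun i _ j _ _ => (partialEnd_commute i j).pow_pow _ _)
    (fun i _ j _ _ => (partialEnd_commute i j).pow_pow _ _)
  refine Eq.trans ?_ h
  apply Finset.noncommProd_congr rfl
  intro i _
  simp [pow_add]

/-- The action of `Q = K[X₀, …, Xₙ]` on `R = K[x₀, …, xₙ]` by constant coefficient differential
operators, `Xᵢ` acting as `∂/∂xᵢ`. Both rings are realised as `MvPolynomial (Fin (n + 1)) K`. -/
def diffOp : MvPolynomial (Fin (n + 1)) K →ₐ[K] Module.End K (MvPolynomial (Fin (n + 1)) K) :=
  AddMonoidAlgebra.lift K (Module.End K (MvPolynomial (Fin (n + 1)) K)) (Fin (n + 1) →₀ ℕ)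
    { toFun := fun m => monomialOp K m.toAdd
      map_one' := monomialOp_zero
      map_mul' := fun m m' => monomialOp_add m.toAdd m'.toAdd }

theorem diffOp_X (i : Fin (n + 1)) (g : MvPolynomial (Fin (n + 1)) K) :
    diffOp (X i) g = pderiv i g := by
  have h : diffOp (X i : MvPolynomial (Fin (n + 1)) K) = monomialOp K (Finsupp.single i 1) := by
    unfold diffOp X monomial
    erw [AddMonoidAlgebra.lift_single]
    simp
  rw [h]
  have h2 : monomialOp K (Finsupp.single i 1) = partialEnd K i := by
    unfold monomialOp
    refine (Finset.mul_noncommProd_erase Finset.univ (Finset.mem_univ i) _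
      (partialEnd_pow_pairwise (Finsupp.single i 1))).symm.trans ?_
    refine (congrArg (_ * ·) (Finset.noncommProd_eq_pow_card _ _ _ 1 ?_)).trans ?_
    · intro j hj
      simp [Finset.ne_of_mem_erase hj]
    · simp
  rw [h2]
  rfl

/-- `Ann_f = {α ∈ Q ∣ α(f) = 0}`. -/
def Ann (f : MvPolynomial (Fin (n + 1)) K) : Ideal (MvPolynomial (Fin (n + 1)) K) where
  carrier := {α | diffOp α f = 0}
  add_mem' := fun {a b} ha hb => by
    simp only [Set.mem_ofPred_eq] at ha hb ⊢
    simp [ha, hb]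
  zero_mem' := by simp
  smul_mem' := fun c a ha => by
    simp only [Set.mem_ofPred_eq] at ha ⊢
    simp [ha]

/-- The graded piece `A_k` of `A = Q / I`: the image of the forms of degree `k`. -/
def gradedPiece (I : Ideal (MvPolynomial (Fin (n + 1)) K)) (k : ℕ) :
    Submodule K (MvPolynomial (Fin (n + 1)) K ⧸ I) :=
  (homogeneousSubmodule (Fin (n + 1)) K k).map (Ideal.Quotient.mkₐ K I).toLinearMap

/-- The graded piece `(I⁻¹)_k` of the Macaulay inverse system of `I`: the forms of degree `k`
that are annihilated by every element of `I`. -/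
def inverseSystem (I : Ideal (MvPolynomial (Fin (n + 1)) K)) (k : ℕ) :
    Submodule K (MvPolynomial (Fin (n + 1)) K) where
  carrier := {g | g.IsHomogeneous k ∧ ∀ α ∈ I, diffOp α g = 0}
  add_mem' := fun {a b} ha hb => ⟨ha.1.add hb.1, fun α hα => by
    rw [map_add, ha.2 α hα, hb.2 α hα, add_zero]⟩
  zero_mem' := ⟨isHomogeneous_zero _ _ _, fun α _ => map_zero _⟩
  smul_mem' := fun c a ha => ⟨(homogeneousSubmodule (Fin (n + 1)) K k).smul_mem c ha.1,
    fun α hα => by rw [map_smul, ha.2 α hα, smul_zero]⟩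

/-- The strong Lefschetz property of `A = Q / I`: there is `L ∈ A₁` such that every
multiplication map `× L^(s-k) : A_k → A_s`, `0 ≤ k < s`, has maximal rank. -/
def HasSLP (I : Ideal (MvPolynomial (Fin (n + 1)) K)) : Prop :=
  ∃ L ∈ gradedPiece I 1, ∀ k s : ℕ, k < s →
    Module.finrank K ((gradedPiece I k).map (LinearMap.mulLeft K (L ^ (s - k)))) =
      min (Module.finrank K (gradedPiece I k)) (Module.finrank K (gradedPiece I s))

/-- The value `a(f)` for a class `a ∈ A = Q / Ann_f`. -/
def applyClass (f : MvPolynomial (Fin (n + 1)) K) (a : MvPolynomial (Fin (n + 1)) K ⧸ Ann f) :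
    MvPolynomial (Fin (n + 1)) K :=
  Quotient.liftOn' a (fun α => diffOp α f) (fun α β h => by
    have h' : α - β ∈ Ann f := (Submodule.quotientRel_def _).1 h
    have h'' : diffOp (α - β) f = 0 := h'
    rw [map_sub, LinearMap.sub_apply, sub_eq_zero] at h''
    exact h'')

/-- The `k`-th Hessian `hess^k_f = det (αᵢ αⱼ (f))` with respect to a basis `(αᵢ)` of `A_k`,
`A = Q / Ann_f`. -/
def hess {ι : Type*} [Fintype ι] [DecidableEq ι] (f : MvPolynomial (Fin (n + 1)) K) {k : ℕ}
    (α : Module.Basis ι K (gradedPiece (Ann f) k)) : MvPolynomial (Fin (n + 1)) K :=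
  (Matrix.of fun i j => applyClass f
    ((α i : MvPolynomial (Fin (n + 1)) K ⧸ Ann f) * (α j))).det

/-! ### Projective varieties and their osculating spaces -/

section Projective

variable {ι : Type*}

/-- The Zariski closure of a set of points of the projective space `ℙ(K^ι)`: the common zeros of
all forms that vanish on the set. -/
def zariskiClosure (S : Set (ℙ K (ι → K))) : Set (ℙ K (ι → K)) :=
  {x | ∀ (e : ℕ) (g : MvPolynomial ι K), g.IsHomogeneous e →
    (∀ y ∈ S, eval y.rep g = 0) → eval x.rep g = 0}

/-- The homogeneous ideal of a set of points of `ℙ(K^ι)`. -/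
def homogeneousIdeal (S : Set (ℙ K (ι → K))) : Ideal (MvPolynomial ι K) :=
  Ideal.span {g | (∃ e : ℕ, g.IsHomogeneous e) ∧ ∀ y ∈ S, eval y.rep g = 0}

/-- The `s`-th osculating space of the projective variety `S` at the point `x`, as a linear
subspace of `K^ι` (so its projective dimension is its vector space dimension minus one).
It is the intersection of the hyperplanes `∑ⱼ aⱼ Xⱼ = 0` whose equation, restricted to `S`,
vanishes at `x` to order at least `s + 1`, that is, which contain the `s`-th infinitesimal
neighbourhood of `x` in `S`. At a smooth point this is the span of all partial derivatives of
order at most `s` of a local parametrization of `S`. The order of vanishing is measured on the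
affine cone, whose ideal is the homogeneous ideal of `S`, at a vector representing `x`. -/
def osculatingSpace [Fintype ι] (S : Set (ℙ K (ι → K))) (s : ℕ) (x : ℙ K (ι → K)) :
    Submodule K (ι → K) where
  carrier := {v | ∀ a : ι → K,
    ∑ j, C (a j) * X j ∈ homogeneousIdeal S ⊔ RingHom.ker (eval x.rep) ^ (s + 1) →
      ∑ j, a j * v j = 0}
  add_mem' := fun {v w} hv hw a ha => by
    simp [mul_add, Finset.sum_add_distrib, hv a ha, hw a ha]
  zero_mem' := fun a _ => by simp
  smul_mem' := fun c v hv a ha => by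
    simp [mul_left_comm, ← Finset.mul_sum, hv a ha]

/-- `p` holds at a general point of the (irreducible) projective variety `S`, i.e. at all points
of some nonempty Zariski open subset of `S` (which may be taken to be a basic open set). -/
def AtGeneralPoint (S : Set (ℙ K (ι → K))) (p : ℙ K (ι → K) → Prop) : Prop :=
  ∃ (e : ℕ) (g : MvPolynomial ι K), g.IsHomogeneous e ∧ (∃ x ∈ S, eval x.rep g ≠ 0) ∧
    ∀ x ∈ S, eval x.rep g ≠ 0 → p x

/-- The closure of the image of the rational map `ℙⁿ ⇢ ℙ(K^ι)`, `P ↦ (F_j(P))_j`, given by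
forms `F_j` of the same degree. -/
def closedImage (F : ι → MvPolynomial (Fin (n + 1)) K) : Set (ℙ K (ι → K)) :=
  zariskiClosure {x | ∃ (P : ℙ K (Fin (n + 1) → K)) (h : (fun j => eval P.rep (F j)) ≠ 0),
    x = Projectivization.mk K (fun j => eval P.rep (F j)) h}

end Projective

/-- The expected (projective) dimension of the `s`-th osculating space at a general point of the
closed image of a rational map `ℙⁿ ⇢ ℙᴺ`. -/
def expectedDim (n s N : ℕ) : ℕ := min ((n + s).choose s - 1) N

/-- For forms `F₀, …, F_N` on `ℙⁿ`, with `X ⊆ ℙᴺ` the closure of the image of the rational map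
they define: at a general point of `X`, the `s`-th osculating space has the expected
dimension. -/
def HasExpectedOsculatingDim {h : ℕ} (F : Fin h → MvPolynomial (Fin (n + 1)) K) (s : ℕ) : Prop :=
  AtGeneralPoint (closedImage F) fun x =>
    Module.finrank K (osculatingSpace (closedImage F) s x) = expectedDim n s (h - 1) + 1

end Apolar

end

/-!
For a point `P` with associated linear form `L_P`, the power `L_P ^ e` acts on forms of degree `e`
as `e!` times evaluation at `P`. Hence `×L_P ^ (d - 2k) : A_k → A_{d-k}` is injective exactly when
the `k`-th Hessian matrix is nondegenerate at `P`. As `A` has a symmetric Hilbert function, these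
injectivities for `2k ≤ d` amount to the strong Lefschetz property of `L_P`, and one `P` serves all
`k` at once as soon as no Hessian vanishes identically.

The hyperplane sections of the polar variety `X_{d-k}` are the derivatives `γ(f)` with `γ ∈ A_k`.
Such a section vanishes to order `k + 1` at `P` iff all its derivatives of order `k` vanish there
(Euler's formula takes care of the lower ones), that is, iff `γ` lies in the kernel of the Hessian
matrix at `P`. So the osculating space at the image of `P` fills the ambient space iff the Hessian
does not vanish at `P`. Here the order of vanishing at `P` in `ℙⁿ` has to be compared with the
order at the image point in `X_{d-k}`: in characteristic zero these agree for general `P` by generic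
smoothness. Conversely, the image of the open set where the Hessian does not vanish contains a
nonempty open subset of `X_{d-k}` by Chevalley's theorem. The points found this way are prime ideals
rather than rational points, so degeneracy of the Hessian matrix is considered modulo any prime.
-/

noncomputable section

namespace Apolar

section GenericSmoothness

theorem mem_ker_pow_of_algebraMap_mem_ker_pow {B S T : Type*} [CommRing B] [CommRing S]
    [CommRing T] [Algebra B S] [Algebra B T] [Algebra.FormallySmooth B S]
    (hT : Function.Surjective (algebraMap B T)) (e : S →ₐ[B] T) {N : ℕ} {p : B}
    (hp : algebraMap B S p ∈ RingHom.ker e ^ N) : p ∈ RingHom.ker (algebraMap B T) ^ N := by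
  rcases Nat.eq_zero_or_pos N with rfl | hN
  · simp
  set m := RingHom.ker (algebraMap B T)
  let g : B ⧸ m ^ N →ₐ[B] T := Ideal.Quotient.liftₐ (m ^ N) (Algebra.ofId B T)
    fun b hb => Ideal.pow_le_self hN.ne' hb
  have hg : Function.Surjective g := fun t =>
    let ⟨b, hb⟩ := hT t; ⟨Ideal.Quotient.mk _ b, hb⟩
  have hker : RingHom.ker g ≤ m.map (Ideal.Quotient.mk (m ^ N)) := by
    intro x hx
    obtain ⟨b, rfl⟩ := Ideal.Quotient.mk_surjective x
    exact Ideal.mem_map_of_mem _ hx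
  have hkerN : RingHom.ker g ^ N = ⊥ := by
    refine eq_bot_iff.2 ((Ideal.pow_right_mono hker N).trans ?_)
    rw [← Ideal.map_pow, Ideal.map_quotient_self]
  let s := Algebra.FormallySmooth.liftOfSurjective e g hg ⟨N, hkerN⟩
  have hs : RingHom.ker e ≤ (RingHom.ker g).comap s := fun x hx => by
    exact (Algebra.FormallySmooth.liftOfSurjective_apply e g hg ⟨N, hkerN⟩ x).trans hx
  have hsp : s (algebraMap B S p) ∈ RingHom.ker g ^ N :=
    Ideal.le_comap_pow s N (Ideal.pow_right_mono hs N hp)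
  rw [hkerN, Ideal.mem_bot, s.commutes] at hsp
  exact Ideal.Quotient.eq_zero_iff_mem.1 hsp

theorem exists_formallySmooth_localizationAway (B S : Type*) [CommRing B] [IsDomain B] [CommRing S]
    [IsDomain S] [CharZero B] [Algebra B S] [FaithfulSMul B S] [Algebra.FinitePresentation B S] :
    ∃ δ : S, δ ≠ 0 ∧ Algebra.FormallySmooth B (Localization.Away δ) := by
  have : Algebra.FormallySmooth B (FractionRing B) := .of_isLocalization (nonZeroDivisors B)
  let _ : Algebra (FractionRing B) (FractionRing S) := FractionRing.liftAlgebra B (FractionRing S)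
  have : Algebra.EssFiniteType (FractionRing B) (FractionRing S) :=
    have : Algebra.EssFiniteType B (FractionRing S) := .comp B S (FractionRing S)
    .of_comp B (FractionRing B) (FractionRing S)
  -- In characteristic zero an essentially finite type field extension is formally smooth.
  have : Algebra.FormallySmooth B (FractionRing S) := .comp B (FractionRing B) (FractionRing S)
  have : Algebra.IsSmoothAt B (⊥ : Ideal S) := by
    change Algebra.FormallySmooth B (Localization (⊥ : Ideal S).primeCompl)
    rwa [Ideal.primeCompl_bot]
  obtain ⟨δ, hδ, _⟩ := Algebra.IsSmoothAt.exists_notMem_smooth B (⊥ : Ideal S)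
  exact ⟨δ, hδ, inferInstance⟩

theorem exists_ne_zero_comap_pow_le_of_faithfulSMul (B S : Type*) [CommRing B] [IsNoetherianRing B]
    [CommRing S] [IsDomain S] [CharZero S] [Algebra B S] [FaithfulSMul B S]
    [Algebra.FiniteType B S] :
    ∃ δ : S, δ ≠ 0 ∧ ∀ m : Ideal S, m.IsMaximal → δ ∉ m →
      Function.Surjective (algebraMap B (S ⧸ m)) → ∀ N : ℕ,
        (m ^ N).comap (algebraMap B S) ≤ m.comap (algebraMap B S) ^ N := by
  have hinj := FaithfulSMul.algebraMap_injective B S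
  have : IsDomain B := hinj.isDomain (algebraMap B S)
  have : CharZero B := (algebraMap B S).charZero
  have : Algebra.FinitePresentation B S := Algebra.FinitePresentation.of_finiteType.1 inferInstance
  obtain ⟨δ, hδ, hsmooth⟩ := exists_formallySmooth_localizationAway B S
  refine ⟨δ, hδ, fun m hm hδm hsurj N p hp => ?_⟩
  let _ := Ideal.Quotient.field m
  have hunit (y : Submonoid.powers δ) : IsUnit (IsScalarTower.toAlgHom B S (S ⧸ m) y) := by
    obtain ⟨_, k, rfl⟩ := y
    rw [map_pow]
    exact (Ne.isUnit (Ideal.Quotient.eq_zero_iff_mem.not.2 hδm)).pow k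
  let e : Localization.Away δ →ₐ[B] S ⧸ m := IsLocalization.liftAlgHom hunit
  have hmax : m.map (algebraMap S (Localization.Away δ)) ≤ RingHom.ker e :=
    Ideal.map_le_iff_le_comap.2 fun x hx =>
      (IsLocalization.lift_eq hunit x).trans (Ideal.Quotient.eq_zero_iff_mem.2 hx)
  have hpe : algebraMap B (Localization.Away δ) p ∈ RingHom.ker e ^ N := by
    rw [IsScalarTower.algebraMap_apply B S]
    refine Ideal.pow_right_mono hmax N ?_
    rw [← Ideal.map_pow]
    exact Ideal.mem_map_of_mem _ hp
  have hker : RingHom.ker (algebraMap B (S ⧸ m)) = m.comap (algebraMap B S) := by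
    rw [IsScalarTower.algebraMap_eq B S, ← RingHom.comap_ker, Ideal.Quotient.algebraMap_eq,
      Ideal.mk_ker]
  exact hker ▸ mem_ker_pow_of_algebraMap_mem_ker_pow hsurj e hpe

theorem exists_ne_zero_comap_pow_le {A S : Type*} [CommRing A] [IsNoetherianRing A] [CommRing S]
    [IsDomain S] [CharZero S] {φ : A →+* S} (hφ : φ.FiniteType) :
    ∃ δ : S, δ ≠ 0 ∧ ∀ m : Ideal S, m.IsMaximal → δ ∉ m →
      Function.Surjective ((Ideal.Quotient.mk m).comp φ) → ∀ N : ℕ,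
        (m ^ N).comap φ ≤ RingHom.ker φ ⊔ m.comap φ ^ N := by
  let _ : Algebra (A ⧸ RingHom.ker φ) S := φ.kerLift.toAlgebra
  have : FaithfulSMul (A ⧸ RingHom.ker φ) S :=
    (faithfulSMul_iff_algebraMap_injective _ _).2 φ.kerLift_injective
  have : Algebra.FiniteType (A ⧸ RingHom.ker φ) S :=
    RingHom.FiniteType.of_comp_finiteType (f := Ideal.Quotient.mk _) (g := φ.kerLift) hφ
  obtain ⟨δ, hδ, h⟩ := exists_ne_zero_comap_pow_le_of_faithfulSMul (A ⧸ RingHom.ker φ) S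
  refine ⟨δ, hδ, fun m hm hδm hsurj N p hp => ?_⟩
  have hsurj' : Function.Surjective (algebraMap (A ⧸ RingHom.ker φ) (S ⧸ m)) := fun t =>
    let ⟨a, ha⟩ := hsurj t; ⟨Ideal.Quotient.mk _ a, ha⟩
  have hcomap : m.comap φ.kerLift ≤ (m.comap φ).map (Ideal.Quotient.mk (RingHom.ker φ)) := by
    intro x hx
    obtain ⟨a, rfl⟩ := Ideal.Quotient.mk_surjective x
    exact Ideal.mem_map_of_mem _ hx
  have hmk : Ideal.Quotient.mk (RingHom.ker φ) p ∈
      (m.comap φ ^ N).map (Ideal.Quotient.mk (RingHom.ker φ)) := by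
    rw [Ideal.map_pow]
    exact Ideal.pow_right_mono hcomap N (h m hm hδm hsurj' N hp)
  rw [← Ideal.mem_comap, Ideal.comap_map_of_surjective' _ Ideal.Quotient.mk_surjective,
    Ideal.mk_ker, sup_comm] at hmk
  exact hmk

theorem exists_forall_isPrime_exists_comap_eq {A S : Type*} [CommRing A] [IsNoetherianRing A]
    [CommRing S] [IsDomain S] {φ : A →+* S} (hφ : φ.FiniteType) {c : S} (hc : c ≠ 0) :
    ∃ g : A, φ g ≠ 0 ∧ ∀ p : Ideal A, p.IsPrime → RingHom.ker φ ≤ p → g ∉ p →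
      ∃ q : Ideal S, q.IsPrime ∧ q.comap φ = p ∧ c ∉ q := by
  -- A constructible set containing the generic point of `V(ker φ)` contains an open subset of it.
  obtain ⟨T, hT⟩ := PrimeSpectrum.exists_constructibleSetData_iff.2 <|
    PrimeSpectrum.isConstructible_comap_image (RingHom.FinitePresentation.of_finiteType.1 hφ)
      (PrimeSpectrum.isConstructible_basicOpen (f := c))
  simp only [PrimeSpectrum.ConstructibleSetData.toSet,
    PrimeSpectrum.BasicConstructibleSetData.toSet, Set.ext_iff, Set.mem_iUnion, Set.mem_sdiff,
    PrimeSpectrum.mem_zeroLocus, Set.singleton_subset_iff, SetLike.mem_coe] at hT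
  obtain ⟨D, hD, hker, hDf⟩ :=
    (hT (PrimeSpectrum.comap φ ⊥)).2 ⟨⊥, hc, rfl⟩
  refine ⟨D.f, hDf, fun p hp hφp hDp => ?_⟩
  obtain ⟨q, hq, hqp⟩ := (hT ⟨p, hp⟩).1 ⟨D, hD, fun a ha => hφp (hker ha), hDp⟩
  exact ⟨q.asIdeal, q.isPrime, congrArg PrimeSpectrum.asIdeal hqp, hq⟩

theorem finiteType_aeval {K σ κ : Type*} [CommRing K] [Finite σ] (F : κ → MvPolynomial σ K) :
    (aeval F : MvPolynomial κ K →ₐ[K] MvPolynomial σ K).toRingHom.FiniteType := by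
  refine RingHom.FiniteType.of_comp_finiteType (f := algebraMap K (MvPolynomial κ K)) ?_
  rw [AlgHom.toRingHom_eq_coe, AlgHom.comp_algebraMap, RingHom.finiteType_algebraMap]
  infer_instance

theorem eval_aeval {K σ κ : Type*} [CommSemiring K] (F : κ → MvPolynomial σ K) (P : σ → K)
    (p : MvPolynomial κ K) : eval P (aeval F p) = eval (fun j => eval P (F j)) p :=
  aeval_bind₁ P F p

theorem exists_forall_mem_ker_aeval_sup {K σ κ : Type*} [Field K] [CharZero K] [Finite σ]
    [Finite κ] (F : κ → MvPolynomial σ K) :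
    ∃ δ : MvPolynomial σ K, δ ≠ 0 ∧ ∀ P : σ → K, eval P δ ≠ 0 → ∀ (N : ℕ) (p : MvPolynomial κ K),
      aeval F p ∈ RingHom.ker (eval P) ^ N →
        p ∈ RingHom.ker (aeval F) ⊔ RingHom.ker (eval fun j => eval P (F j)) ^ N := by
  obtain ⟨δ, hδ, h⟩ := exists_ne_zero_comap_pow_le (finiteType_aeval F)
  refine ⟨δ, hδ, fun P hP N p hp => ?_⟩
  have hmax : (RingHom.ker (eval P)).IsMaximal :=
    RingHom.ker_isMaximal_of_surjective _ fun c => ⟨C c, eval_C c⟩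
  have hcomap : (RingHom.ker (eval P)).comap (aeval F : MvPolynomial κ K →ₐ[K] _).toRingHom =
      RingHom.ker (eval fun j => eval P (F j)) :=
    Ideal.ext fun q => by
      simp only [Ideal.mem_comap, RingHom.mem_ker, AlgHom.toRingHom_eq_coe, RingHom.coe_coe,
        eval_aeval]
  rw [← hcomap]
  refine h _ hmax hP (fun t => ?_) N hp
  obtain ⟨g, rfl⟩ := Ideal.Quotient.mk_surjective t
  refine ⟨C (eval P g), Ideal.Quotient.eq.2 ?_⟩
  simp [RingHom.mem_ker]

end GenericSmoothness

section Forms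

variable {R σ : Type*} [CommSemiring R]

/-- The linear form `∑ Pᵢ xᵢ` with coefficient vector `P`. As a differential operator it is the
directional derivative along `P`. -/
def linForm [Fintype σ] (P : σ → R) : MvPolynomial σ R := ∑ i, C (P i) * X i

theorem isHomogeneous_linForm [Fintype σ] (P : σ → R) : (linForm P).IsHomogeneous 1 :=
  IsHomogeneous.sum _ _ _ fun i _ => isHomogeneous_C_mul_X (P i) i

theorem exists_linForm_eq [Fintype σ] {g : MvPolynomial σ R} (hg : g.IsHomogeneous 1) :
    ∃ P : σ → R, linForm P = g := by
  rw [← mem_homogeneousSubmodule, homogeneousSubmodule_one_eq_span_X,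
    Submodule.mem_span_range_iff_exists_fun] at hg
  simpa only [linForm, C_mul'] using hg

theorem aeval_linForm {A : Type*} [Fintype σ] [CommSemiring A] [Algebra R A] (F : σ → A)
    (a : σ → R) : aeval F (linForm a) = ∑ i, a i • F i := by
  simp [linForm, Algebra.smul_def]

@[elab_as_elim]
theorem isHomogeneous_induction [Fintype σ]
    {motive : (k : ℕ) → (g : MvPolynomial σ R) → g.IsHomogeneous k → Prop}
    (const : ∀ c, motive 0 (C c) (isHomogeneous_C σ c))
    (add : ∀ k a b ha hb, motive k a ha → motive k b hb → motive k (a + b) (ha.add hb))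
    (mul_linForm : ∀ k a ha P, motive k a ha →
      motive (k + 1) (a * linForm P) (ha.mul (isHomogeneous_linForm P)))
    {k : ℕ} {g : MvPolynomial σ R} (hg : g.IsHomogeneous k) : motive k g hg := by
  have hg' : g ∈ homogeneousSubmodule σ R 1 ^ k := by rwa [homogeneousSubmodule_one_pow]
  induction hg' using Submodule.pow_induction_on_right' with
  | algebraMap c => exact const c
  | add a b k ha hb iha ihb =>
    rw [homogeneousSubmodule_one_pow] at ha hb
    exact add k a b ha hb (iha ha) (ihb hb)
  | mul_mem k a ha iha ℓ hℓ =>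
    rw [homogeneousSubmodule_one_pow] at ha
    obtain ⟨P, rfl⟩ := exists_linForm_eq hℓ
    exact mul_linForm k a ha P (iha ha)

instance finite_homogeneousSubmodule [Finite σ] (k : ℕ) :
    Module.Finite R (homogeneousSubmodule σ R k) :=
  Module.Finite.iff_fg.2 (homogeneousSubmodule_fg _ _ k)

theorem finrank_homogeneousSubmodule {R : Type*} [CommRing R] [Nontrivial R] [Fintype σ]
    (k : ℕ) :
    Module.finrank R (homogeneousSubmodule σ R k) = (Fintype.card σ + k - 1).choose k := by
  classical
  have hset : {s : σ →₀ ℕ | s.degree = k} = (Finset.univ : Finset σ).finsuppAntidiag k := by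
    ext s
    simp [Finsupp.degree_eq_sum]
  rw [homogeneousSubmodule_eq_finsupp_supported, hset]
  refine (Module.finrank_eq_nat_card_basis (basisRestrictSupport R _)).trans ?_
  rw [Nat.card_coe_set_eq, Set.ncard_coe_finset, Finset.card_finsuppAntidiag_nat_eq_choose,
    Finset.card_univ]

theorem eq_C_of_isHomogeneous_zero {g : MvPolynomial σ R} (hg : g.IsHomogeneous 0) :
    g = C (coeff 0 g) :=
  totalDegree_eq_zero_iff_eq_C.1 ((totalDegree_zero_iff_isHomogeneous σ).2 hg)

theorem mkDerivation_apply {A : Type*} [Fintype σ] [AddCommMonoid A] [Module R A]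
    [Module (MvPolynomial σ R) A] [IsScalarTower R (MvPolynomial σ R) A] (v : σ → A)
    (g : MvPolynomial σ R) :
    mkDerivation R v g = ∑ i, pderiv i g • v i := by
  induction g using MvPolynomial.induction_on with
  | C c => simp
  | add a b ha hb => simp only [map_add, ha, hb, add_smul, Finset.sum_add_distrib]
  | mul_X a j ha =>
    classical
    simp [ha, pderiv_X, Pi.single_apply, add_smul, Finset.sum_add_distrib, Finset.smul_sum,
      mul_smul, ite_smul]

theorem eval_eq_zero_of_eval_pderiv_eq_zero [IsDomain R] [CharZero R] [Finite σ]
    {g : MvPolynomial σ R} {e : ℕ} (hg : g.IsHomogeneous (e + 1)) {P : σ → R}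
    (h : ∀ i, eval P (pderiv i g) = 0) : eval P g = 0 := by
  cases nonempty_fintype σ
  have euler := congrArg (eval P) hg.sum_X_mul_pderiv
  simpa [h, e.cast_add_one_ne_zero] using euler.symm

theorem exists_eval_ne_zero {R : Type*} [CommRing R] [IsDomain R] [Infinite R]
    {g : MvPolynomial σ R} (hg : g ≠ 0) : ∃ P, eval P g ≠ 0 := by
  by_contra! h
  exact hg (MvPolynomial.funext fun P => by rw [h P, map_zero])

end Forms

section Order

variable {K A : Type*} [CommRing K] [CommRing A] [Algebra K A]

theorem derivation_mem_pow (D : Derivation K A A) (I : Ideal A) {s : ℕ} {a : A}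
    (ha : a ∈ I ^ (s + 1)) : D a ∈ I ^ s := by
  induction s generalizing a with
  | zero => simp
  | succ s ih =>
    rw [pow_succ'] at ha
    refine Submodule.mul_induction_on ha (fun x hx y hy => ?_) fun x y hx hy => ?_
    · rw [D.leibniz, smul_eq_mul, smul_eq_mul]
      refine add_mem ?_ (Ideal.mul_mem_right _ _ hy)
      rw [pow_succ']
      exact Ideal.mul_mem_mul hx (ih hy)
    · rw [map_add]
      exact add_mem hx hy

theorem derivation_sub_nsmul_mem_pow {D : Derivation K A A} {I : Ideal A}
    (hD : ∀ b ∈ I, D b - b ∈ I ^ 2) {s : ℕ} {a : A} (ha : a ∈ I ^ (s + 1)) :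
    D a - (s + 1) • a ∈ I ^ (s + 2) := by
  induction s generalizing a with
  | zero => simpa using hD a (by simpa using ha)
  | succ s ih =>
    rw [pow_succ'] at ha
    refine Submodule.mul_induction_on ha (fun x hx y hy => ?_) fun x y hx hy => ?_
    · have h₁ : x * (D y - (s + 1) • y) ∈ I ^ (s + 3) := by
        rw [pow_succ']
        exact Ideal.mul_mem_mul hx (ih hy)
      have h₂ : y * (D x - x) ∈ I ^ (s + 3) := by
        rw [show s + 3 = s + 1 + 2 from rfl, pow_add]
        exact Ideal.mul_mem_mul hy (hD x hx)
      convert add_mem h₁ h₂ using 1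
      simp only [D.leibniz, smul_eq_mul, nsmul_eq_mul]
      push_cast
      ring
    · rw [map_add, smul_add, add_sub_add_comm]
      exact add_mem hx hy

variable {σ : Type*}

theorem X_sub_C_mem_ker_eval (P : σ → K) (i : σ) : X i - C (P i) ∈ RingHom.ker (eval P) := by
  simp [RingHom.mem_ker]

theorem mkDerivation_X_sub_C_sub_mem_pow (P : σ → K) (g : MvPolynomial σ K) :
    mkDerivation K (fun i => X i - C (P i)) g - (g - C (eval P g)) ∈
      RingHom.ker (eval P) ^ 2 := by
  induction g using MvPolynomial.induction_on with
  | C c => simp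
  | add a b ha hb =>
    convert add_mem ha hb using 1
    simp only [map_add]
    ring
  | mul_X a i ha =>
    have hmul : (a - C (eval P a)) * (X i - C (P i)) ∈ RingHom.ker (eval P) ^ 2 := by
      rw [pow_two]
      exact Ideal.mul_mem_mul (by simp [RingHom.mem_ker]) (X_sub_C_mem_ker_eval P i)
    convert add_mem (Ideal.mul_mem_right (X i) _ ha) hmul using 1
    simp only [Derivation.leibniz, mkDerivation_X, smul_eq_mul, map_mul, eval_X]
    ring

end Order

section OrderOfForms

variable {K σ : Type*} [Field K] [CharZero K] [Finite σ]

theorem mem_ker_eval_pow_succ_of_pderiv_mem {P : σ → K} {g : MvPolynomial σ K} (hg : eval P g = 0)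
    {s : ℕ} (h : ∀ i, pderiv i g ∈ RingHom.ker (eval P) ^ s) :
    g ∈ RingHom.ker (eval P) ^ (s + 1) := by
  induction s with
  | zero => simpa using hg
  | succ s ih =>
    set m := RingHom.ker (eval P)
    set D := mkDerivation K fun i => X i - C (P i)
    have hgm : g ∈ m ^ (s + 1) := ih fun i => Ideal.pow_le_pow_right s.le_succ (h i)
    have hD (b : MvPolynomial σ K) (hb : b ∈ m) : D b - b ∈ m ^ 2 := by
      simpa [RingHom.mem_ker.1 hb] using mkDerivation_X_sub_C_sub_mem_pow P b
    -- `D g` is `(s + 1) g` up to `m ^ (s + 2)`, so it suffices that `D g` lies in `m ^ (s + 2)`.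
    have hDg : D g ∈ m ^ (s + 2) := by
      cases nonempty_fintype σ
      rw [mkDerivation_apply, pow_succ]
      exact sum_mem fun i _ => Ideal.mul_mem_mul (h i) (X_sub_C_mem_ker_eval P i)
    have hsg : ((s + 1 : ℕ) : K) • g ∈ (m ^ (s + 2)).restrictScalars K := by
      simpa only [Nat.cast_smul_eq_nsmul, sub_sub_cancel, Submodule.restrictScalars_mem] using
        sub_mem hDg (derivation_sub_nsmul_mem_pow hD hgm)
    exact (Submodule.smul_mem_iff _ (Nat.cast_ne_zero.2 s.succ_ne_zero)).1 hsg

end OrderOfForms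

section Action

variable {K : Type*} [Field K] {n : ℕ} {α g : MvPolynomial (Fin (n + 1)) K} {e k m : ℕ}

theorem diffOp_mul (α β g : MvPolynomial (Fin (n + 1)) K) :
    diffOp (α * β) g = diffOp α (diffOp β g) := by
  rw [map_mul, Module.End.mul_apply]

theorem diffOp_C (c : K) (g : MvPolynomial (Fin (n + 1)) K) : diffOp (C c) g = c • g := by
  rw [← algebraMap_eq, AlgHom.commutes, Module.algebraMap_end_apply]

theorem diffOp_linForm (P : Fin (n + 1) → K) (g : MvPolynomial (Fin (n + 1)) K) :
    diffOp (linForm P) g = mkDerivation K (fun i => C (P i)) g := by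
  rw [mkDerivation_apply, linForm, map_sum, LinearMap.sum_apply]
  refine Finset.sum_congr rfl fun i _ => ?_
  rw [diffOp_mul, diffOp_X, diffOp_C, smul_eq_C_mul, smul_eq_mul, mul_comm]

theorem isHomogeneous_diffOp_linForm (P : Fin (n + 1) → K) (hg : g.IsHomogeneous (e + 1)) :
    (diffOp (linForm P) g).IsHomogeneous e := by
  rw [diffOp_linForm, mkDerivation_apply]
  exact IsHomogeneous.sum _ _ _ fun i _ => hg.pderiv.mul (isHomogeneous_C _ _)

theorem isHomogeneous_diffOp (hα : α.IsHomogeneous k) (hg : g.IsHomogeneous (k + e)) :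
    (diffOp α g).IsHomogeneous e := by
  induction hα using isHomogeneous_induction generalizing g with
  | const c =>
    rw [diffOp_C]
    exact (homogeneousSubmodule _ K e).smul_mem c (zero_add e ▸ hg)
  | add k a b _ _ iha ihb =>
    rw [map_add, LinearMap.add_apply]
    exact (iha hg).add (ihb hg)
  | mul_linForm k a _ P iha =>
    rw [diffOp_mul]
    exact iha (isHomogeneous_diffOp_linForm P (by rwa [add_right_comm] at hg))

theorem diffOp_eq_zero_of_lt (hα : α.IsHomogeneous k) (hg : g.IsHomogeneous m) (hmk : m < k) :
    diffOp α g = 0 := by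
  induction hα using isHomogeneous_induction generalizing g m with
  | const c => exact absurd hmk m.not_lt_zero
  | add k a b _ _ iha ihb => rw [map_add, LinearMap.add_apply, iha hg hmk, ihb hg hmk, add_zero]
  | mul_linForm k a _ P iha =>
    rw [diffOp_mul]
    cases m with
    | zero => rw [eq_C_of_isHomogeneous_zero hg, diffOp_linForm, derivation_C, map_zero]
    | succ m => exact iha (isHomogeneous_diffOp_linForm P hg) (Nat.lt_of_succ_lt_succ hmk)

theorem diffOp_mem_pow (I : Ideal (MvPolynomial (Fin (n + 1)) K)) (hα : α.IsHomogeneous k) {s : ℕ}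
    (hg : g ∈ I ^ (s + k)) : diffOp α g ∈ I ^ s := by
  induction hα using isHomogeneous_induction generalizing g with
  | const c =>
    rw [diffOp_C]
    exact Submodule.smul_of_tower_mem _ c hg
  | add k a b _ _ iha ihb =>
    rw [map_add, LinearMap.add_apply]
    exact add_mem (iha hg) (ihb hg)
  | mul_linForm k a _ P iha =>
    rw [diffOp_mul, diffOp_linForm]
    exact iha (derivation_mem_pow _ I hg)

theorem diffOp_linForm_pow (P : Fin (n + 1) → K) (hg : g.IsHomogeneous e) :
    diffOp (linForm P ^ e) g = C (e.factorial * eval P g) := by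
  induction e generalizing g with
  | zero =>
    rw [eq_C_of_isHomogeneous_zero hg]
    simp
  | succ e ih =>
    have euler : eval P (diffOp (linForm P) g) = (e + 1) * eval P g := by
      have h := congrArg (eval P) hg.sum_X_mul_pderiv
      rw [diffOp_linForm, mkDerivation_apply]
      simpa [mul_comm] using h
    rw [pow_succ, diffOp_mul, ih (isHomogeneous_diffOp_linForm P hg), euler, Nat.factorial_succ]
    congr 1
    push_cast
    ring

variable [CharZero K]

theorem eq_zero_of_diffOp_eq_zero (hg : g.IsHomogeneous e)
    (h : ∀ β : MvPolynomial (Fin (n + 1)) K, β.IsHomogeneous e → diffOp β g = 0) : g = 0 := by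
  refine MvPolynomial.funext fun P => ?_
  have hP := h (linForm P ^ e) (by simpa using (isHomogeneous_linForm P).pow e)
  rw [diffOp_linForm_pow P hg, C_eq_zero] at hP
  simpa [e.factorial_ne_zero] using hP

theorem mem_ker_eval_pow_of_eval_diffOp_eq_zero {P : Fin (n + 1) → K} (hg : g.IsHomogeneous m)
    (hkm : k ≤ m)
    (h : ∀ β : MvPolynomial (Fin (n + 1)) K, β.IsHomogeneous k → eval P (diffOp β g) = 0) :
    g ∈ RingHom.ker (eval P) ^ (k + 1) := by
  induction k generalizing g m with
  | zero => simpa using h 1 (isHomogeneous_one _ _)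
  | succ k ih =>
    obtain ⟨m, rfl⟩ := Nat.exists_eq_add_of_le' (Nat.succ_pos k |>.trans_le hkm)
    have hpderiv (i : Fin (n + 1)) : pderiv i g ∈ RingHom.ker (eval P) ^ (k + 1) := by
      refine ih hg.pderiv (by omega) fun β hβ => ?_
      rw [← diffOp_X, ← diffOp_mul]
      exact h _ (hβ.mul (isHomogeneous_X _ i))
    refine mem_ker_eval_pow_succ_of_pderiv_mem ?_ hpderiv
    exact eval_eq_zero_of_eval_pderiv_eq_zero hg fun i =>
      Ideal.pow_le_self k.succ_ne_zero (hpderiv i)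

end Action

section Gorenstein

variable {K : Type*} [Field K] {n : ℕ} {I : Ideal (MvPolynomial (Fin (n + 1)) K)}
  {f g : MvPolynomial (Fin (n + 1)) K} {d e k l s : ℕ}

theorem mem_Ann {α : MvPolynomial (Fin (n + 1)) K} : α ∈ Ann f ↔ diffOp α f = 0 := Iff.rfl

theorem mem_gradedPiece {a : MvPolynomial (Fin (n + 1)) K ⧸ I} :
    a ∈ gradedPiece I k ↔ ∃ γ, γ.IsHomogeneous k ∧ Ideal.Quotient.mk I γ = a :=
  Iff.rfl

theorem mk_mem_gradedPiece {γ : MvPolynomial (Fin (n + 1)) K} (hγ : γ.IsHomogeneous k) :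
    Ideal.Quotient.mk I γ ∈ gradedPiece I k :=
  ⟨γ, hγ, rfl⟩

instance gradedMonoid_gradedPiece (I : Ideal (MvPolynomial (Fin (n + 1)) K)) :
    SetLike.GradedMonoid (gradedPiece I) where
  one_mem := ⟨1, isHomogeneous_one _ _, map_one (Ideal.Quotient.mk I)⟩
  mul_mem := by
    rintro k l _ _ ⟨α, hα, rfl⟩ ⟨β, hβ, rfl⟩
    exact ⟨α * β, hα.mul hβ, map_mul (Ideal.Quotient.mk I) α β⟩

instance finite_gradedPiece (I : Ideal (MvPolynomial (Fin (n + 1)) K)) (k : ℕ) :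
    Module.Finite K (gradedPiece I k) := by
  unfold gradedPiece
  infer_instance

theorem finrank_gradedPiece_le (I : Ideal (MvPolynomial (Fin (n + 1)) K)) (k : ℕ) :
    Module.finrank K (gradedPiece I k) ≤ (n + k).choose k := by
  refine (Submodule.finrank_map_le _ _).trans_eq ?_
  rw [finrank_homogeneousSubmodule, Fintype.card_fin, Nat.add_right_comm, Nat.add_sub_cancel]

/-- The action `a ↦ a(f)` of `A = Q / Ann_f` on `f` as a linear map, so that sums and scalars can be
pulled out of `applyClass`. -/
def applyHom (f : MvPolynomial (Fin (n + 1)) K) :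
    (MvPolynomial (Fin (n + 1)) K ⧸ Ann f) →ₗ[K] MvPolynomial (Fin (n + 1)) K where
  toFun := applyClass f
  map_add' a b := by
    obtain ⟨α, rfl⟩ := Ideal.Quotient.mk_surjective a
    obtain ⟨β, rfl⟩ := Ideal.Quotient.mk_surjective b
    exact LinearMap.congr_fun (map_add diffOp α β) f
  map_smul' c a := by
    obtain ⟨α, rfl⟩ := Ideal.Quotient.mk_surjective a
    exact LinearMap.congr_fun (map_smul diffOp c α) f

theorem applyHom_mk (f α : MvPolynomial (Fin (n + 1)) K) :
    applyHom f (Ideal.Quotient.mk _ α) = diffOp α f := rfl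

theorem applyHom_injective (f : MvPolynomial (Fin (n + 1)) K) :
    Function.Injective (applyHom f) := by
  refine (injective_iff_map_eq_zero _).2 fun a ha => ?_
  obtain ⟨α, rfl⟩ := Ideal.Quotient.mk_surjective a
  exact Ideal.Quotient.eq_zero_iff_mem.2 ha

theorem gradedPiece_Ann_eq_bot (hf : f.IsHomogeneous d) (hs : d < s) :
    gradedPiece (Ann f) s = ⊥ := by
  refine eq_bot_iff.2 ?_
  rintro _ ⟨γ, hγ, rfl⟩
  exact Ideal.Quotient.eq_zero_iff_mem.2 (diffOp_eq_zero_of_lt hγ hf hs)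

variable [CharZero K]

theorem exists_diffOp_eq_C (ℓ : MvPolynomial (Fin (n + 1)) K →ₗ[K] K) (e : ℕ) :
    ∃ β : MvPolynomial (Fin (n + 1)) K, β.IsHomogeneous e ∧
      ∀ g : MvPolynomial (Fin (n + 1)) K, g.IsHomogeneous e → diffOp β g = C (ℓ g) := by
  let V := homogeneousSubmodule (Fin (n + 1)) K e
  let B : V →ₗ[K] V →ₗ[K] K :=
    (diffOp.toLinearMap.compr₂ (lcoeff K (0 : Fin (n + 1) →₀ ℕ))).domRestrict₁₂ V V
  have hC (β g : V) : diffOp (β : MvPolynomial (Fin (n + 1)) K) g = C (B β g) :=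
    eq_C_of_isHomogeneous_zero (isHomogeneous_diffOp β.2 g.2)
  have hB : Function.Injective B.flip := by
    refine (injective_iff_map_eq_zero _).2 fun g hg => Subtype.ext ?_
    refine eq_zero_of_diffOp_eq_zero g.2 fun β hβ => ?_
    rw [hC ⟨β, hβ⟩ g, ← B.flip_apply, hg, LinearMap.zero_apply, C_0]
  obtain ⟨β, hβ⟩ := LinearMap.flip_surjective_iff₁.2 hB (ℓ.domRestrict V)
  refine ⟨β, β.2, fun g hg => ?_⟩
  rw [hC β ⟨g, hg⟩]
  exact congrArg C (LinearMap.congr_fun hβ ⟨g, hg⟩)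

theorem mem_inverseSystem_Ann_iff (hf : f.IsHomogeneous (e + k)) :
    g ∈ inverseSystem (Ann f) k ↔ ∃ β, β.IsHomogeneous e ∧ diffOp β f = g := by
  constructor
  · intro hg
    let V := (homogeneousSubmodule (Fin (n + 1)) K e).map (diffOp.toLinearMap.flip f)
    change g ∈ V
    by_contra hgV
    obtain ⟨ℓ, hℓg, hV⟩ := Submodule.exists_le_ker_of_notMem hgV
    obtain ⟨α, hα, hαℓ⟩ := exists_diffOp_eq_C ℓ k
    have hαf : α ∈ Ann f := by
      refine eq_zero_of_diffOp_eq_zero (isHomogeneous_diffOp hα (add_comm e k ▸ hf))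
        fun β hβ => ?_
      have hβV : diffOp β f ∈ V := Submodule.mem_map_of_mem (f := diffOp.toLinearMap.flip f) hβ
      rw [← diffOp_mul, mul_comm, diffOp_mul, hαℓ _ (isHomogeneous_diffOp hβ hf), hV hβV, C_0]
    refine hℓg (C_injective (Fin (n + 1)) K ?_)
    rw [← hαℓ g hg.1, hg.2 α hαf, C_0]
  · rintro ⟨β, hβ, rfl⟩
    refine ⟨isHomogeneous_diffOp hβ hf, fun α hα => ?_⟩
    rw [← diffOp_mul, mul_comm, diffOp_mul, mem_Ann.1 hα, map_zero]

theorem map_applyHom_gradedPiece_Ann (hf : f.IsHomogeneous (e + k)) :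
    (gradedPiece (Ann f) e).map (applyHom f) = inverseSystem (Ann f) k := by
  ext g
  rw [mem_inverseSystem_Ann_iff hf]
  constructor
  · rintro ⟨_, ⟨β, hβ, rfl⟩, rfl⟩
    exact ⟨β, hβ, rfl⟩
  · rintro ⟨β, hβ, rfl⟩
    exact ⟨_, mk_mem_gradedPiece hβ, rfl⟩

theorem finrank_inverseSystem_Ann (hf : f.IsHomogeneous (e + k)) :
    Module.finrank K (inverseSystem (Ann f) k) = Module.finrank K (gradedPiece (Ann f) e) := by
  rw [← map_applyHom_gradedPiece_Ann hf]
  exact (Submodule.equivMapOfInjective _ (applyHom_injective f) _).finrank_eq.symm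

theorem finrank_gradedPiece_Ann_le (hf : f.IsHomogeneous (k + l)) :
    Module.finrank K (gradedPiece (Ann f) k) ≤ Module.finrank K (gradedPiece (Ann f) l) := by
  let B : gradedPiece (Ann f) k →ₗ[K] gradedPiece (Ann f) l →ₗ[K] K :=
    ((LinearMap.mul K (MvPolynomial (Fin (n + 1)) K ⧸ Ann f)).compr₂
      (lcoeff K 0 ∘ₗ applyHom f)).domRestrict₁₂ _ _
  have hB : Function.Injective B := by
    refine (injective_iff_map_eq_zero _).2 ?_
    rintro ⟨_, γ, hγ, rfl⟩ hBγ
    have hγf : (diffOp γ f).IsHomogeneous l := isHomogeneous_diffOp hγ hf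
    refine Subtype.ext (Ideal.Quotient.eq_zero_iff_mem.2 ?_)
    refine eq_zero_of_diffOp_eq_zero hγf fun β hβ => ?_
    have hcoeff : coeff 0 (diffOp (γ * β) f) = 0 :=
      LinearMap.congr_fun hBγ ⟨_, mk_mem_gradedPiece hβ⟩
    rw [eq_C_of_isHomogeneous_zero (isHomogeneous_diffOp hβ hγf), ← diffOp_mul, mul_comm, hcoeff,
      C_0]
  exact (LinearMap.finrank_le_finrank_of_injective hB).trans_eq Subspace.dual_finrank_eq

theorem finrank_gradedPiece_Ann_symm (hf : f.IsHomogeneous (k + l)) :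
    Module.finrank K (gradedPiece (Ann f) k) = Module.finrank K (gradedPiece (Ann f) l) :=
  (finrank_gradedPiece_Ann_le hf).antisymm (finrank_gradedPiece_Ann_le (add_comm k l ▸ hf))

end Gorenstein

section Hessian

variable {K : Type*} [Field K] {n : ℕ} {f : MvPolynomial (Fin (n + 1)) K} {k : ℕ}

/-- The `k`-th Hessian matrix of `f`, viewed as the form `(β, γ) ↦ βγ(f)` on `A_k` and reduced
modulo the ideal `q`, has trivial kernel among the vectors with constant entries. Reducing modulo
the ideal of a point `P` evaluates the Hessian matrix at `P`. -/
def HessNondegenerateAt (f : MvPolynomial (Fin (n + 1)) K) (k : ℕ)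
    (q : Ideal (MvPolynomial (Fin (n + 1)) K)) : Prop :=
  ∀ γ : MvPolynomial (Fin (n + 1)) K, γ.IsHomogeneous k →
    (∀ β : MvPolynomial (Fin (n + 1)) K, β.IsHomogeneous k → diffOp (β * γ) f ∈ q) →
      diffOp γ f = 0

theorem sum_repr_smul_coe {R V ι : Type*} [Semiring R] [AddCommMonoid V] [Module R V] [Fintype ι]
    {M : Submodule R V} (b : Module.Basis ι R M) (a : M) : ∑ j, b.repr a j • (b j : V) = a := by
  simpa only [AddSubmonoidClass.coe_finsetSum, Submodule.coe_smul] using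
    congrArg Subtype.val (b.sum_repr a)

theorem map_hessMatrix_mulVec {ι T : Type*} [Fintype ι] [DecidableEq ι] [CommRing T]
    (φ : MvPolynomial (Fin (n + 1)) K →+* T) (α : ι → MvPolynomial (Fin (n + 1)) K ⧸ Ann f)
    (c : ι → K) (i : ι) :
    (φ.mapMatrix (Matrix.of fun i j => applyClass f (α i * α j))).mulVec (fun j => φ (C (c j))) i =
      φ (applyHom f (α i * ∑ j, c j • α j)) := by
  simp only [Matrix.mulVec, dotProduct, RingHom.mapMatrix_apply, Matrix.map_apply,
    Matrix.of_apply, Finset.mul_sum, mul_smul_comm, map_sum, map_smul, smul_eq_C_mul, map_mul]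
  exact Finset.sum_congr rfl fun j _ => mul_comm _ _

variable {ι : Type*} [Fintype ι] [DecidableEq ι]

theorem hessNondegenerateAt_of_hess_notMem {α : Module.Basis ι K (gradedPiece (Ann f) k)}
    {q : Ideal (MvPolynomial (Fin (n + 1)) K)} [q.IsPrime] (h : hess f α ∉ q) :
    HessNondegenerateAt f k q := by
  intro γ hγ hq
  let φ := Ideal.Quotient.mk q
  let a : gradedPiece (Ann f) k := ⟨Ideal.Quotient.mk _ γ, mk_mem_gradedPiece hγ⟩
  have ha : ∑ j, α.repr a j • (α j : MvPolynomial (Fin (n + 1)) K ⧸ Ann f) =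
      Ideal.Quotient.mk _ γ := sum_repr_smul_coe α a
  have hdet : (φ.mapMatrix
      (Matrix.of fun i j => applyClass f ((α i : _ ⧸ Ann f) * α j))).det ≠ 0 := by
    rw [← RingHom.map_det]
    exact mt Ideal.Quotient.eq_zero_iff_mem.1 h
  have hrepr := Matrix.eq_zero_of_mulVec_eq_zero hdet (v := fun j => φ (C (α.repr a j))) <| by
    funext i
    obtain ⟨β, hβ, hβi⟩ := mem_gradedPiece.1 (α i).2
    rw [map_hessMatrix_mulVec φ (fun i => (α i : _ ⧸ Ann f)), ha, ← hβi, ← map_mul, applyHom_mk]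
    exact Ideal.Quotient.eq_zero_iff_mem.2 (hq β hβ)
  have hrepr_zero (j : ι) : α.repr a j = 0 :=
    (injective_iff_map_eq_zero (φ.comp C)).1 (φ.comp C).injective _ (congrFun hrepr j)
  rw [← mem_Ann, ← Ideal.Quotient.eq_zero_iff_mem, ← ha]
  simp only [hrepr_zero, zero_smul, Finset.sum_const_zero]

theorem eval_hess_ne_zero {P : Fin (n + 1) → K} (h : HessNondegenerateAt f k (RingHom.ker (eval P)))
    (α : Module.Basis ι K (gradedPiece (Ann f) k)) : eval P (hess f α) ≠ 0 := by
  intro hdet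
  rw [hess, RingHom.map_det] at hdet
  obtain ⟨c, hc, hMc⟩ := Matrix.exists_mulVec_eq_zero_iff.2 hdet
  obtain ⟨γ, hγ, hγc⟩ := mem_gradedPiece.1 (∑ j, c j • α j).2
  simp only [AddSubmonoidClass.coe_finsetSum, Submodule.coe_smul] at hγc
  have hker (b : gradedPiece (Ann f) k) :
      eval P (applyHom f ((b : _ ⧸ Ann f) * Ideal.Quotient.mk _ γ)) = 0 := by
    have hrow (i : ι) : eval P (applyHom f ((α i : _ ⧸ Ann f) * Ideal.Quotient.mk _ γ)) = 0 := by
      rw [hγc, ← map_hessMatrix_mulVec _ (fun i => (α i : _ ⧸ Ann f))]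
      simpa only [eval_C, Pi.zero_apply] using congrFun hMc i
    simp only [← sum_repr_smul_coe α b, Finset.sum_mul, smul_mul_assoc, map_sum, map_smul,
      smul_eval, hrow, mul_zero, Finset.sum_const_zero]
  have hγf : diffOp γ f = 0 := h γ hγ fun β hβ => hker ⟨_, mk_mem_gradedPiece hβ⟩
  rw [← mem_Ann, ← Ideal.Quotient.eq_zero_iff_mem, hγc] at hγf
  refine hc (funext (Fintype.linearIndependent_iff.1 α.linearIndependent c (Subtype.ext ?_)))
  simpa using hγf

theorem hess_ne_zero_iff [CharZero K] (α : Module.Basis ι K (gradedPiece (Ann f) k)) :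
    hess f α ≠ 0 ↔ ∃ P, HessNondegenerateAt f k (RingHom.ker (eval P)) := by
  constructor
  · intro h
    obtain ⟨P, hP⟩ := exists_eval_ne_zero h
    have := RingHom.ker_isPrime (eval P)
    exact ⟨P, hessNondegenerateAt_of_hess_notMem hP⟩
  · rintro ⟨P, hP⟩ h
    exact eval_hess_ne_zero hP α (by rw [h, map_zero])

theorem hessNondegenerateAt_zero {q : Ideal (MvPolynomial (Fin (n + 1)) K)} (hf : f ∉ q) :
    HessNondegenerateAt f 0 q := by
  intro γ hγ hq
  have hmem : γ.coeff 0 • f ∈ q.restrictScalars K := by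
    simpa only [Submodule.restrictScalars_mem, one_mul, ← diffOp_C,
      ← eq_C_of_isHomogeneous_zero hγ] using hq 1 (isHomogeneous_one _ _)
  have hcoeff : γ.coeff 0 = 0 := by_contra fun hne => hf ((Submodule.smul_mem_iff _ hne).1 hmem)
  rw [eq_C_of_isHomogeneous_zero hγ, hcoeff, C_0, map_zero, LinearMap.zero_apply]

end Hessian

section Lefschetz

theorem finrank_map_eq_iff {K V W : Type*} [Field K] [AddCommGroup V] [Module K V]
    [AddCommGroup W] [Module K W] (T : V →ₗ[K] W) (M : Submodule K V) [Module.Finite K M] :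
    Module.finrank K (M.map T) = Module.finrank K M ↔ ∀ a ∈ M, T a = 0 → a = 0 := by
  have hrank := (T.domRestrict M).finrank_range_add_finrank_ker
  rw [LinearMap.range_domRestrict] at hrank
  have hker : Module.finrank K (LinearMap.ker (T.domRestrict M)) = 0 ↔
      ∀ a ∈ M, T a = 0 → a = 0 := by
    simp [Submodule.finrank_eq_zero, LinearMap.ker_eq_bot']
  rw [← hker]
  omega

variable {K A : Type*} [Field K] [CommRing A] [Algebra K A] {𝒜 : ℕ → Submodule K A}
  [SetLike.GradedMonoid 𝒜] {L : A} {d : ℕ}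

theorem map_mulLeft_pow_le (hL : L ∈ 𝒜 1) (e k : ℕ) :
    (𝒜 k).map (LinearMap.mulLeft K (L ^ e)) ≤ 𝒜 (e + k) := by
  rintro _ ⟨b, hb, rfl⟩
  have hLe : L ^ e ∈ 𝒜 e := by simpa using SetLike.pow_mem_graded e hL
  exact SetLike.mul_mem_graded hLe hb

theorem map_mulLeft_pow_add_le (hL : L ∈ 𝒜 1) (e c l : ℕ) :
    (𝒜 l).map (LinearMap.mulLeft K (L ^ (e + c))) ≤
      (𝒜 (c + l)).map (LinearMap.mulLeft K (L ^ e)) := by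
  rw [pow_add, LinearMap.mulLeft_mul, Submodule.map_comp]
  exact Submodule.map_mono (map_mulLeft_pow_le hL c l)

variable [∀ k, Module.Finite K (𝒜 k)]

theorem finrank_le_finrank_map_of_injOn (hL : L ∈ 𝒜 1) {k l e c : ℕ} (hk : k = c + l)
    (hrank : Module.finrank K (𝒜 l) = Module.finrank K (𝒜 (e + k)))
    (hinj : ∀ a ∈ 𝒜 l, L ^ (e + c) * a = 0 → a = 0) :
    Module.finrank K (𝒜 (e + k)) ≤
      Module.finrank K ((𝒜 k).map (LinearMap.mulLeft K (L ^ e))) := by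
  rw [← hrank, ← (finrank_map_eq_iff (LinearMap.mulLeft K (L ^ (e + c))) (𝒜 l)).2 hinj, hk]
  exact Submodule.finrank_mono (map_mulLeft_pow_add_le hL e c l)

theorem maximalRank_of_symmetric_injOn
    (hsymm : ∀ k l, k + l = d → Module.finrank K (𝒜 k) = Module.finrank K (𝒜 l))
    (hbot : ∀ s, d < s → 𝒜 s = ⊥) (hL : L ∈ 𝒜 1)
    (hinj : ∀ k e, 2 * k + e = d → ∀ a ∈ 𝒜 k, L ^ e * a = 0 → a = 0) (k e : ℕ) :
    Module.finrank K ((𝒜 k).map (LinearMap.mulLeft K (L ^ e))) =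
      min (Module.finrank K (𝒜 k)) (Module.finrank K (𝒜 (e + k))) := by
  refine le_antisymm (le_min (Submodule.finrank_map_le _ _)
    (Submodule.finrank_mono (map_mulLeft_pow_le hL e k))) (min_le_iff.2 ?_)
  rcases lt_or_ge d (e + k) with hs | hs
  · right
    rw [hbot _ hs, finrank_bot]
    exact Nat.zero_le _
  rcases le_total (2 * k + e) d with hd | hd
  · obtain ⟨c, hc⟩ := Nat.exists_eq_add_of_le hd
    refine .inl ((finrank_map_eq_iff _ _).2 fun a ha h => ?_).ge
    refine hinj k (c + e) (by omega) a ha ?_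
    rw [pow_add, mul_assoc, ← LinearMap.mulLeft_apply K (L ^ e), h, mul_zero]
  · obtain ⟨l, hl⟩ := Nat.exists_eq_add_of_le' hs
    obtain ⟨c, rfl⟩ := Nat.exists_eq_add_of_le' (show l ≤ k by omega)
    exact .inr (finrank_le_finrank_map_of_injOn hL rfl (hsymm _ _ hl.symm)
      (hinj l (e + c) (by omega)))

theorem maximalRank_iff_of_symmetric
    (hsymm : ∀ k l, k + l = d → Module.finrank K (𝒜 k) = Module.finrank K (𝒜 l))
    (hbot : ∀ s, d < s → 𝒜 s = ⊥) (hL : L ∈ 𝒜 1) :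
    (∀ k s, k < s → Module.finrank K ((𝒜 k).map (LinearMap.mulLeft K (L ^ (s - k)))) =
        min (Module.finrank K (𝒜 k)) (Module.finrank K (𝒜 s))) ↔
      ∀ k e, 2 * k + e = d → ∀ a ∈ 𝒜 k, L ^ e * a = 0 → a = 0 := by
  constructor
  · intro hmax k e hd
    rcases Nat.eq_zero_or_pos e with rfl | he
    · simp
    have hrank := hmax k (k + e) (Nat.lt_add_of_pos_right he)
    rw [← hsymm k (k + e) (by omega), min_self, Nat.add_sub_cancel_left] at hrank
    exact (finrank_map_eq_iff _ _).1 hrank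
  · intro hinj k s hks
    obtain ⟨e, rfl⟩ := Nat.exists_eq_add_of_le' hks.le
    rw [Nat.add_sub_cancel]
    exact maximalRank_of_symmetric_injOn hsymm hbot hL hinj k e

end Lefschetz

section StrongLefschetz

variable {K : Type*} [Field K] {n : ℕ} {f : MvPolynomial (Fin (n + 1)) K}
  {P : Fin (n + 1) → K} {d e k : ℕ}

theorem diffOp_diffOp_linForm_pow_mul (hf : f.IsHomogeneous (2 * k + e))
    {β γ : MvPolynomial (Fin (n + 1)) K} (hβ : β.IsHomogeneous k) (hγ : γ.IsHomogeneous k) :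
    diffOp β (diffOp (linForm P ^ e * γ) f) = C (e.factorial * eval P (diffOp (β * γ) f)) := by
  have hβγ : (diffOp (β * γ) f).IsHomogeneous e :=
    isHomogeneous_diffOp (two_mul k ▸ hβ.mul hγ) hf
  rw [← diffOp_linForm_pow P hβγ, ← diffOp_mul, ← diffOp_mul, mul_left_comm]

variable [CharZero K]

theorem diffOp_linForm_pow_mul_eq_zero_iff (hf : f.IsHomogeneous (2 * k + e))
    {γ : MvPolynomial (Fin (n + 1)) K} (hγ : γ.IsHomogeneous k) :
    diffOp (linForm P ^ e * γ) f = 0 ↔ ∀ β : MvPolynomial (Fin (n + 1)) K,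
      β.IsHomogeneous k → eval P (diffOp (β * γ) f) = 0 := by
  have hγf : (diffOp (linForm P ^ e * γ) f).IsHomogeneous k :=
    isHomogeneous_diffOp (by simpa only [one_mul] using ((isHomogeneous_linForm P).pow e).mul hγ)
      (by convert hf using 1; ring)
  constructor
  · intro h β hβ
    have hC := diffOp_diffOp_linForm_pow_mul (P := P) hf hβ hγ
    rw [h, map_zero, eq_comm, C_eq_zero, mul_eq_zero] at hC
    exact hC.resolve_left (Nat.cast_ne_zero.2 e.factorial_ne_zero)
  · refine fun h => eq_zero_of_diffOp_eq_zero hγf fun β hβ => ?_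
    rw [diffOp_diffOp_linForm_pow_mul hf hβ hγ, h β hβ, mul_zero, C_0]

theorem hessNondegenerateAt_ker_eval_iff (hf : f.IsHomogeneous (2 * k + e)) :
    HessNondegenerateAt f k (RingHom.ker (eval P)) ↔ ∀ a ∈ gradedPiece (Ann f) k,
      Ideal.Quotient.mk (Ann f) (linForm P) ^ e * a = 0 → a = 0 := by
  have hmk {γ : MvPolynomial (Fin (n + 1)) K} (hγ : γ.IsHomogeneous k) :
      Ideal.Quotient.mk (Ann f) (linForm P) ^ e * Ideal.Quotient.mk (Ann f) γ = 0 ↔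
        ∀ β : MvPolynomial (Fin (n + 1)) K, β.IsHomogeneous k →
          eval P (diffOp (β * γ) f) = 0 := by
    rw [← map_pow, ← map_mul, Ideal.Quotient.eq_zero_iff_mem, mem_Ann,
      diffOp_linForm_pow_mul_eq_zero_iff hf hγ]
  constructor
  · rintro h _ ⟨γ, hγ, rfl⟩ hγ0
    exact Ideal.Quotient.eq_zero_iff_mem.2 (h γ hγ ((hmk hγ).1 hγ0))
  · intro h γ hγ hγ0
    exact Ideal.Quotient.eq_zero_iff_mem.1 (h _ (mk_mem_gradedPiece hγ) ((hmk hγ).2 hγ0))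

theorem maximalRank_mk_linForm_iff (hf : f.IsHomogeneous d) :
    (∀ k s, k < s → Module.finrank K ((gradedPiece (Ann f) k).map (LinearMap.mulLeft K
        (Ideal.Quotient.mk (Ann f) (linForm P) ^ (s - k)))) =
      min (Module.finrank K (gradedPiece (Ann f) k))
        (Module.finrank K (gradedPiece (Ann f) s))) ↔
    ∀ k, 2 * k ≤ d → HessNondegenerateAt f k (RingHom.ker (eval P)) := by
  have hsymm (k l : ℕ) (hd : k + l = d) : Module.finrank K (gradedPiece (Ann f) k) =
      Module.finrank K (gradedPiece (Ann f) l) :=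
    finrank_gradedPiece_Ann_symm (hd ▸ hf)
  refine (maximalRank_iff_of_symmetric hsymm (fun s => gradedPiece_Ann_eq_bot hf)
    (mk_mem_gradedPiece (isHomogeneous_linForm P))).trans ?_
  constructor
  · intro h k hk
    obtain ⟨e, rfl⟩ := Nat.exists_eq_add_of_le hk
    exact (hessNondegenerateAt_ker_eval_iff hf).2 (h k e rfl)
  · rintro h k e rfl
    exact (hessNondegenerateAt_ker_eval_iff hf).1 (h k (Nat.le_add_right _ _))

theorem hasSLP_Ann_iff_exists (hf : f.IsHomogeneous d) :
    HasSLP (Ann f) ↔ ∃ P, ∀ k, 2 * k ≤ d → HessNondegenerateAt f k (RingHom.ker (eval P)) := by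
  constructor
  · rintro ⟨L, hL, hmax⟩
    obtain ⟨ℓ, hℓ, rfl⟩ := mem_gradedPiece.1 hL
    obtain ⟨P, rfl⟩ := exists_linForm_eq hℓ
    exact ⟨P, (maximalRank_mk_linForm_iff hf).1 hmax⟩
  · rintro ⟨P, h⟩
    exact ⟨_, mk_mem_gradedPiece (isHomogeneous_linForm P), (maximalRank_mk_linForm_iff hf).2 h⟩

theorem hasSLP_Ann_iff_forall_hess_ne_zero (hf : f.IsHomogeneous d) {ι : ℕ → Type*}
    [∀ k, Fintype (ι k)] [∀ k, DecidableEq (ι k)]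
    (α : ∀ k, Module.Basis (ι k) K (gradedPiece (Ann f) k)) :
    HasSLP (Ann f) ↔ ∀ k, 2 * k ≤ d → hess f (α k) ≠ 0 := by
  rw [hasSLP_Ann_iff_exists hf]
  constructor
  · rintro ⟨P, hP⟩ k hk
    exact (hess_ne_zero_iff (α k)).2 ⟨P, hP k hk⟩
  · intro h
    have hprod : ∏ k ∈ Finset.range (d + 1) with 2 * k ≤ d, hess f (α k) ≠ 0 :=
      Finset.prod_ne_zero_iff.2 fun k hk => h k (Finset.mem_filter.1 hk).2
    obtain ⟨P, hP⟩ := exists_eval_ne_zero hprod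
    rw [map_prod, Finset.prod_ne_zero_iff] at hP
    have := RingHom.ker_isPrime (eval P)
    refine ⟨P, fun k hk => hessNondegenerateAt_of_hess_notMem (α := α k) (hP k ?_)⟩
    exact Finset.mem_filter.2 ⟨Finset.mem_range.2 (by omega), hk⟩

end StrongLefschetz

section Cone

variable {K : Type*} [Field K] {κ : Type*}

theorem aeval_smul_of_isHomogeneous {R A σ : Type*} [CommSemiring R] [CommSemiring A] [Algebra R A]
    {m : ℕ} {g : MvPolynomial σ R} (hg : g.IsHomogeneous m) (a : A) (y : σ → A) :
    aeval (a • y) g = a ^ m * aeval y g := by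
  rw [aeval_def, aeval_def, eval₂_eq, eval₂_eq, Finset.mul_sum]
  refine Finset.sum_congr rfl fun s hs => ?_
  rw [hg.degree_eq_sum_deg_support hs, ← Finset.prod_pow_eq_pow_sum]
  simp only [Pi.smul_apply, smul_eq_mul, mul_pow, Finset.prod_mul_distrib]
  ring

theorem eval_smul_of_isHomogeneous {R σ : Type*} [CommSemiring R] {m : ℕ}
    {g : MvPolynomial σ R} (hg : g.IsHomogeneous m) (c : R) (v : σ → R) :
    eval (c • v) g = c ^ m * eval v g := by
  simpa only [aeval_eq_eval] using aeval_smul_of_isHomogeneous hg c v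

theorem eval_rep_mk_eq_zero_iff {g : MvPolynomial κ K} {m : ℕ} (hg : g.IsHomogeneous m)
    {v : κ → K} (hv : v ≠ 0) :
    eval (Projectivization.mk K v hv).rep g = 0 ↔ eval v g = 0 := by
  obtain ⟨a, ha⟩ := Projectivization.exists_smul_eq_mk_rep K v hv
  rw [← ha, Units.smul_def, eval_smul_of_isHomogeneous hg,
    mul_eq_zero_iff_left (pow_ne_zero _ a.ne_zero)]

theorem eq_zero_of_eval_rep_eq_zero [Infinite K] {g : MvPolynomial κ K} {m : ℕ}
    (hg : g.IsHomogeneous m) (hm : 0 < m) (h : ∀ x : ℙ K (κ → K), eval x.rep g = 0) : g = 0 := by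
  refine MvPolynomial.funext fun v => ?_
  rw [map_zero]
  rcases eq_or_ne v 0 with rfl | hv
  · simpa [hm.ne'] using eval_smul_of_isHomogeneous hg 0 0
  · exact (eval_rep_mk_eq_zero_iff hg hv).1 (h _)

theorem coeff_aeval_X_smul {R σ : Type*} [CommSemiring R] (v : σ → R) (m : ℕ)
    (g : MvPolynomial σ R) :
    (aeval ((Polynomial.X : Polynomial R) • (Polynomial.C ∘ v)) g).coeff m =
      eval v (homogeneousComponent m g) := by
  induction g using MvPolynomial.induction_on' with
  | monomial s c =>
    have hs : (monomial s c : MvPolynomial σ R).IsHomogeneous s.degree :=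
      isHomogeneous_monomial c rfl
    have hC : aeval (Polynomial.C ∘ v) (monomial s c : MvPolynomial σ R) =
        Polynomial.C (eval v (monomial s c)) := by
      simp [aeval_monomial, eval_monomial, Finsupp.prod]
    rw [homogeneousComponent_of_mem hs, aeval_smul_of_isHomogeneous hs, hC, mul_comm,
      Polynomial.coeff_C_mul_X_pow]
    split_ifs <;> simp
  | add p q hp hq => simp only [map_add, Polynomial.coeff_add, hp, hq]

theorem exists_eval_smul_ne_zero [Infinite K] {g : MvPolynomial κ K} {m : ℕ} {v : κ → K}
    (h : eval v (homogeneousComponent m g) ≠ 0) : ∃ c : K, c ≠ 0 ∧ eval (c • v) g ≠ 0 := by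
  let p := aeval ((Polynomial.X : Polynomial K) • (Polynomial.C ∘ v)) g
  have hp_eval (c : K) : p.eval c = eval (c • v) g := by
    rw [← Polynomial.coe_aeval_eq_eval c, ← AlgHom.comp_apply, comp_aeval, ← aeval_eq_eval]
    refine congrArg (fun w => aeval w g) (_root_.funext fun j => ?_)
    simp only [Pi.smul_apply, Function.comp_apply, smul_eq_mul, map_mul, Polynomial.aeval_X,
      Polynomial.aeval_C, Algebra.algebraMap_self, RingHom.id_apply]
  have hp : p ≠ 0 := fun hp => h <| by
    rw [← coeff_aeval_X_smul, ← Polynomial.coeff_zero m]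
    exact congrArg (Polynomial.coeff · m) hp
  by_contra! hc
  refine mul_ne_zero hp Polynomial.X_ne_zero (Polynomial.funext fun c => ?_)
  rw [Polynomial.eval_mul, Polynomial.eval_X, Polynomial.eval_zero, hp_eval, mul_eq_zero, or_comm]
  exact or_iff_not_imp_left.2 (hc c)

theorem homogeneousComponent_aeval {R σ τ : Type*} [CommSemiring R] {F : τ → MvPolynomial σ R}
    {e : ℕ} (he : 0 < e) (hF : ∀ j, (F j).IsHomogeneous e) (m : ℕ) (g : MvPolynomial τ R) :
    homogeneousComponent (e * m) (aeval F g) = aeval F (homogeneousComponent m g) := by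
  induction g using MvPolynomial.induction_on' with
  | monomial s c =>
    have hs : (monomial s c : MvPolynomial τ R).IsHomogeneous s.degree :=
      isHomogeneous_monomial c rfl
    rw [homogeneousComponent_of_mem (hs.aeval F hF), homogeneousComponent_of_mem hs]
    simp only [Nat.mul_right_inj he.ne']
    split_ifs <;> simp
  | add p q hp hq => simp only [map_add, hp, hq]

theorem ker_aeval_eq_span {R σ τ : Type*} [CommRing R] {F : τ → MvPolynomial σ R} {e : ℕ}
    (he : 0 < e) (hF : ∀ j, (F j).IsHomogeneous e) :
    RingHom.ker (aeval F : MvPolynomial τ R →ₐ[R] MvPolynomial σ R) =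
      Ideal.span {g | (∃ m, g.IsHomogeneous m) ∧ aeval F g = 0} := by
  refine le_antisymm (fun g hg => ?_) (Ideal.span_le.2 fun g hg => hg.2)
  rw [← sum_homogeneousComponent g]
  refine sum_mem fun m _ => Ideal.subset_span ⟨⟨m, homogeneousComponent_isHomogeneous m g⟩, ?_⟩
  rw [← homogeneousComponent_aeval he hF, RingHom.mem_ker.1 hg, map_zero]

end Cone

section ClosedImage

variable {K : Type*} [Field K] {κ : Type*} {n e : ℕ}
  {F : κ → MvPolynomial (Fin (n + 1)) K}

theorem forall_mem_image_eval_rep_eq_zero_iff [Infinite K] (he : 0 < e)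
    (hF : ∀ j, (F j).IsHomogeneous e) (hF0 : ∃ j, F j ≠ 0) {g : MvPolynomial κ K} {m : ℕ}
    (hg : g.IsHomogeneous m) :
    (∀ y ∈ {y | ∃ (P : ℙ K (Fin (n + 1) → K)) (h : (fun j => eval P.rep (F j)) ≠ 0),
      y = Projectivization.mk K (fun j => eval P.rep (F j)) h}, eval y.rep g = 0) ↔
      aeval F g = 0 := by
  constructor
  · intro h
    obtain ⟨j, hj⟩ := hF0
    suffices hmul : aeval F g * F j = 0 from (mul_eq_zero.1 hmul).resolve_right hj
    refine eq_zero_of_eval_rep_eq_zero ((hg.aeval F hF).mul (hF j)) (by positivity) fun P => ?_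
    rw [map_mul, mul_eq_zero, or_iff_not_imp_right, eval_aeval]
    intro hPj
    have hne : (fun j => eval P.rep (F j)) ≠ 0 := fun h0 => hPj (congrFun h0 j)
    exact (eval_rep_mk_eq_zero_iff hg hne).1 (h _ ⟨P, hne, rfl⟩)
  · rintro h _ ⟨P, hP, rfl⟩
    rw [eval_rep_mk_eq_zero_iff hg, ← eval_aeval, h, map_zero]

theorem mem_closedImage_iff [Infinite K] (he : 0 < e) (hF : ∀ j, (F j).IsHomogeneous e)
    (hF0 : ∃ j, F j ≠ 0) {x : ℙ K (κ → K)} :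
    x ∈ closedImage F ↔ RingHom.ker (aeval F) ≤ RingHom.ker (eval x.rep) := by
  rw [ker_aeval_eq_span he hF, Ideal.span_le]
  constructor
  · rintro hx g ⟨⟨m, hm⟩, hg⟩
    exact hx m g hm ((forall_mem_image_eval_rep_eq_zero_iff he hF hF0 hm).2 hg)
  · intro hx m g hm hg
    exact hx ⟨⟨m, hm⟩, (forall_mem_image_eval_rep_eq_zero_iff he hF hF0 hm).1 hg⟩

theorem homogeneousIdeal_closedImage [Infinite K] (he : 0 < e) (hF : ∀ j, (F j).IsHomogeneous e)
    (hF0 : ∃ j, F j ≠ 0) : homogeneousIdeal (closedImage F) = RingHom.ker (aeval F) := by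
  rw [ker_aeval_eq_span he hF, homogeneousIdeal]
  congr 1
  ext g
  refine and_congr_right fun ⟨m, hm⟩ => ?_
  rw [← forall_mem_image_eval_rep_eq_zero_iff he hF hF0 hm]
  exact ⟨fun h y hy => h y fun _ _ _ hg => hg y hy, fun h x hx => hx m g hm h⟩

theorem mk_mem_closedImage_iff [Infinite K] (he : 0 < e) (hF : ∀ j, (F j).IsHomogeneous e)
    (hF0 : ∃ j, F j ≠ 0) {v : κ → K} (hv : v ≠ 0) :
    Projectivization.mk K v hv ∈ closedImage F ↔
      RingHom.ker (aeval F) ≤ RingHom.ker (eval v) := by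
  rw [mem_closedImage_iff he hF hF0, ker_aeval_eq_span he hF, Ideal.span_le, Ideal.span_le]
  refine forall₂_congr fun g ⟨⟨m, hm⟩, _⟩ => ?_
  exact eval_rep_mk_eq_zero_iff hm hv

theorem exists_aeval_homogeneousComponent_ne_zero {R σ τ : Type*} [CommSemiring R]
    {F : τ → MvPolynomial σ R} {g : MvPolynomial τ R} (hg : aeval F g ≠ 0) :
    ∃ m, aeval F (homogeneousComponent m g) ≠ 0 := by
  by_contra! h
  refine hg ?_
  rw [← sum_homogeneousComponent g, map_sum]
  exact Finset.sum_eq_zero fun m _ => h m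

theorem atGeneralPoint_closedImage_iff [Infinite K] (he : 0 < e)
    (hF : ∀ j, (F j).IsHomogeneous e) (hF0 : ∃ j, F j ≠ 0) {p : (κ → K) → Prop}
    (hp : ∀ (c : K) (v : κ → K), c ≠ 0 → p (c • v) → p v) :
    AtGeneralPoint (closedImage F) (fun x => p x.rep) ↔
      ∃ g, aeval F g ≠ 0 ∧ ∀ v ≠ 0, RingHom.ker (aeval F) ≤ RingHom.ker (eval v) →
        eval v g ≠ 0 → p v := by
  constructor
  · rintro ⟨m, g, hg, ⟨x, hx, hxg⟩, hgen⟩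
    refine ⟨g, fun h => hxg ((mem_closedImage_iff he hF hF0).1 hx h), fun v hv hker hvg => ?_⟩
    have hrep := hgen _ ((mk_mem_closedImage_iff he hF hF0 hv).2 hker)
      (mt (eval_rep_mk_eq_zero_iff hg hv).1 hvg)
    obtain ⟨a, ha⟩ := Projectivization.exists_smul_eq_mk_rep K v hv
    exact hp a v a.ne_zero (by rwa [← Units.smul_def, ha])
  · rintro ⟨g, hg, hgen⟩
    obtain ⟨m, hm⟩ := exists_aeval_homogeneousComponent_ne_zero hg
    have hhom := homogeneousComponent_isHomogeneous m g
    refine ⟨m, homogeneousComponent m g, hhom, ?_, fun x hx hxg => ?_⟩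
    · by_contra! h
      refine hm ((forall_mem_image_eval_rep_eq_zero_iff he hF hF0 hhom).1 fun y hy => ?_)
      exact h y fun _ _ _ hz => hz y hy
    · obtain ⟨c, hc, hcg⟩ := exists_eval_smul_ne_zero hxg
      have hcx : c • x.rep ≠ 0 := smul_ne_zero hc x.rep_nonzero
      refine hp c _ hc (hgen _ hcx ?_ hcg)
      have hmk : Projectivization.mk K (c • x.rep) hcx = x :=
        ((Projectivization.mk_eq_mk_iff' K _ _ hcx x.rep_nonzero).2 ⟨c, rfl⟩).trans x.mk_rep
      rwa [← mk_mem_closedImage_iff he hF hF0 hcx, hmk]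

end ClosedImage

section OsculatingSpace

variable {K κ : Type*} [Field K] [Fintype κ] {n s : ℕ}

/-- At the point `v` of the affine cone over the closed image of `F`, no hyperplane contains the
`s`-th infinitesimal neighbourhood, so that the `s`-th osculating space is the whole space. The
ideal of the cone is encoded as the ideal of algebraic relations between the `F j`. -/
def HasFullOsculatingSpaceAt {σ : Type*} (F : κ → MvPolynomial σ K) (s : ℕ) (v : κ → K) : Prop :=
  ∀ a : κ → K, linForm a ∈ RingHom.ker (aeval F) ⊔ RingHom.ker (eval v) ^ (s + 1) → a = 0

theorem finrank_osculatingSpace_eq_card_iff {S : Set (ℙ K (κ → K))} {x : ℙ K (κ → K)} :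
    Module.finrank K (osculatingSpace S s x) = Fintype.card κ ↔ ∀ a : κ → K,
      linForm a ∈ homogeneousIdeal S ⊔ RingHom.ker (eval x.rep) ^ (s + 1) → a = 0 := by
  classical
  rw [← Module.finrank_fintype_fun_eq_card K]
  constructor
  · intro h a ha
    have htop := Submodule.eq_top_of_finrank_eq h
    funext j
    have hj : Pi.single j 1 ∈ osculatingSpace S s x := htop ▸ Submodule.mem_top
    simpa [Pi.single_apply] using hj a ha
  · intro h
    have htop : osculatingSpace S s x = ⊤ :=
      eq_top_iff.2 fun v _ a ha => by simp [h a ha]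
    rw [htop, finrank_top]

theorem HasFullOsculatingSpaceAt.of_smul {σ : Type*} {F : κ → MvPolynomial σ K} {e : ℕ}
    (he : 0 < e) (hF : ∀ j, (F j).IsHomogeneous e) {c : K} {v : κ → K} (hc : c ≠ 0)
    (h : HasFullOsculatingSpaceAt F s (c • v)) : HasFullOsculatingSpaceAt F s v := by
  intro a ha
  let φ : MvPolynomial κ K →ₐ[K] MvPolynomial κ K :=
    aeval ((C c⁻¹ : MvPolynomial κ K) • X)
  have hφ_lin : φ (linForm a) = linForm (c⁻¹ • a) := by
    simp [φ, linForm, mul_left_comm, mul_assoc]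
  have hφ_ker : (RingHom.ker (aeval F)).map φ ≤ RingHom.ker (aeval F) := by
    conv_lhs => rw [ker_aeval_eq_span he hF, Ideal.map_span]
    refine Ideal.span_le.2 ?_
    rintro _ ⟨g, ⟨⟨m, hg⟩, hgF⟩, rfl⟩
    change aeval F (aeval ((C c⁻¹ : MvPolynomial κ K) • X) g) = 0
    rw [aeval_smul_of_isHomogeneous hg, aeval_X_left_apply, map_mul, hgF, mul_zero]
  have hφ_eval : (RingHom.ker (eval v)).map φ ≤ RingHom.ker (eval (c • v)) := by
    refine Ideal.map_le_iff_le_comap.2 fun g hg => ?_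
    change eval (c • v) (aeval ((C c⁻¹ : MvPolynomial κ K) • X) g) = 0
    rw [eval_aeval]
    simpa [hc] using hg
  have hmap := Ideal.mem_map_of_mem φ ha
  rw [hφ_lin, Ideal.map_sup, Ideal.map_pow] at hmap
  have hsmul := h _ (sup_le_sup hφ_ker (Ideal.pow_right_mono hφ_eval (s + 1)) hmap)
  exact (smul_eq_zero_iff_right (inv_ne_zero hc)).1 hsmul

theorem hasExpectedOsculatingDim_iff_exists [Infinite K] {h e : ℕ}
    {F : Fin h → MvPolynomial (Fin (n + 1)) K} (he : 0 < e) (hF : ∀ j, (F j).IsHomogeneous e)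
    (hF0 : ∃ j, F j ≠ 0) (hh : h ≤ (n + s).choose s) :
    HasExpectedOsculatingDim F s ↔ ∃ g, aeval F g ≠ 0 ∧ ∀ v ≠ 0,
      RingHom.ker (aeval F) ≤ RingHom.ker (eval v) → eval v g ≠ 0 →
        HasFullOsculatingSpaceAt F s v := by
  have hdim : expectedDim n s (h - 1) + 1 = Fintype.card (Fin h) := by
    obtain ⟨j, _⟩ := hF0
    have hpos := j.pos
    rw [Fintype.card_fin, expectedDim, min_eq_right (Nat.sub_le_sub_right hh 1)]
    omega
  rw [← atGeneralPoint_closedImage_iff (p := HasFullOsculatingSpaceAt F s) he hF hF0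
    fun c v hc => .of_smul he hF hc]
  simp only [HasExpectedOsculatingDim, HasFullOsculatingSpaceAt, hdim,
    finrank_osculatingSpace_eq_card_iff, homogeneousIdeal_closedImage he hF hF0]

end OsculatingSpace

section PolarVariety

variable {K κ : Type*} [Field K] [CharZero K] [Fintype κ] {n k m : ℕ}
  {f : MvPolynomial (Fin (n + 1)) K}

theorem exists_linForm_aeval_eq (hf : f.IsHomogeneous (k + m))
    (F : Module.Basis κ K (inverseSystem (Ann f) m)) {γ : MvPolynomial (Fin (n + 1)) K}
    (hγ : γ.IsHomogeneous k) :
    ∃ a : κ → K, aeval (fun j => (F j : MvPolynomial (Fin (n + 1)) K)) (linForm a) =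
      diffOp γ f := by
  let g : inverseSystem (Ann f) m := ⟨_, (mem_inverseSystem_Ann_iff hf).2 ⟨γ, hγ, rfl⟩⟩
  exact ⟨F.repr g, (aeval_linForm _ _).trans (sum_repr_smul_coe F g)⟩

theorem HessNondegenerateAt.hasFullOsculatingSpaceAt {q : Ideal (MvPolynomial (Fin (n + 1)) K)}
    (h : HessNondegenerateAt f k q) (hf : f.IsHomogeneous (k + m))
    (F : Module.Basis κ K (inverseSystem (Ann f) m)) {v : κ → K}
    (hv : RingHom.ker (eval v) ≤
      q.comap (aeval fun j => (F j : MvPolynomial (Fin (n + 1)) K))) :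
    HasFullOsculatingSpaceAt (fun j => (F j : MvPolynomial (Fin (n + 1)) K)) k v := by
  intro a ha
  set φ := aeval (R := K) fun j => (F j : MvPolynomial (Fin (n + 1)) K)
  have hφa : φ (linForm a) ∈ q ^ (k + 1) := by
    refine (sup_le (c := (q ^ (k + 1)).comap φ) (Ideal.comap_mono bot_le) ?_) ha
    exact (Ideal.pow_right_mono hv (k + 1)).trans (Ideal.le_comap_pow φ (k + 1))
  have hφ : φ (linForm a) = ((∑ j, a j • F j : inverseSystem (Ann f) m) : _) := by
    rw [aeval_linForm]
    simp
  obtain ⟨γ, hγ, hγf⟩ := (mem_inverseSystem_Ann_iff hf).1 (∑ j, a j • F j).2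
  rw [← hφ] at hγf
  have hzero : diffOp γ f = 0 := h γ hγ fun β hβ => by
    rw [diffOp_mul, hγf, ← pow_one q]
    exact diffOp_mem_pow q hβ (by rwa [add_comm 1 k])
  rw [hγf, hφ] at hzero
  exact _root_.funext
    (Fintype.linearIndependent_iff.1 F.linearIndependent a (Subtype.ext hzero))

theorem HasFullOsculatingSpaceAt.hessNondegenerateAt {P : Fin (n + 1) → K}
    {F : Module.Basis κ K (inverseSystem (Ann f) m)}
    (h : HasFullOsculatingSpaceAt (fun j => (F j : MvPolynomial (Fin (n + 1)) K)) k
      fun j => eval P (F j : MvPolynomial (Fin (n + 1)) K))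
    (hf : f.IsHomogeneous (k + m)) (hkm : k ≤ m)
    (hP : ∀ p, aeval (fun j => (F j : MvPolynomial (Fin (n + 1)) K)) p ∈
        RingHom.ker (eval P) ^ (k + 1) →
      p ∈ RingHom.ker (aeval fun j => (F j : MvPolynomial (Fin (n + 1)) K)) ⊔
        RingHom.ker (eval fun j => eval P (F j : MvPolynomial (Fin (n + 1)) K)) ^ (k + 1)) :
    HessNondegenerateAt f k (RingHom.ker (eval P)) := by
  intro γ hγ hγP
  obtain ⟨a, ha⟩ := exists_linForm_aeval_eq hf F hγ
  have hpow : diffOp γ f ∈ RingHom.ker (eval P) ^ (k + 1) :=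
    mem_ker_eval_pow_of_eval_diffOp_eq_zero (isHomogeneous_diffOp hγ hf) hkm fun β hβ => by
      rw [← diffOp_mul]
      exact hγP β hβ
  rw [← ha, h a (hP _ (ha ▸ hpow)), aeval_linForm]
  simp

theorem exists_diffOp_ne_zero (hf : f.IsHomogeneous (k + m)) (hf0 : f ≠ 0) :
    ∃ γ : MvPolynomial (Fin (n + 1)) K, γ.IsHomogeneous k ∧ diffOp γ f ≠ 0 := by
  obtain ⟨P, hP⟩ := exists_eval_ne_zero hf0
  refine ⟨linForm P ^ k, by simpa using (isHomogeneous_linForm P).pow k, fun h => ?_⟩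
  have hC := diffOp_linForm_pow P hf
  rw [add_comm k m, pow_add, diffOp_mul, h, map_zero, eq_comm, C_eq_zero, mul_eq_zero] at hC
  exact hC.elim (Nat.cast_ne_zero.2 (Nat.factorial_ne_zero _)) hP

theorem exists_basis_inverseSystem_Ann_ne_zero (hf : f.IsHomogeneous (k + m)) (hf0 : f ≠ 0)
    {ι : Type*} (F : Module.Basis ι K (inverseSystem (Ann f) m)) :
    ∃ j, (F j : MvPolynomial (Fin (n + 1)) K) ≠ 0 := by
  obtain ⟨γ, hγ, hγf⟩ := exists_diffOp_ne_zero hf hf0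
  let g : inverseSystem (Ann f) m := ⟨_, (mem_inverseSystem_Ann_iff hf).2 ⟨γ, hγ, rfl⟩⟩
  have : Nontrivial (inverseSystem (Ann f) m) := ⟨g, 0, mt (congrArg Subtype.val) hγf⟩
  obtain ⟨j⟩ := F.index_nonempty
  exact ⟨j, fun h => F.ne_zero j (Subtype.ext h)⟩

theorem hasExpectedOsculatingDim_iff_hess_ne_zero (hf : f.IsHomogeneous (k + m)) (hf0 : f ≠ 0)
    (hkm : k ≤ m) (hm : 0 < m) {ι : Type*} [Fintype ι] [DecidableEq ι]
    (α : Module.Basis ι K (gradedPiece (Ann f) k))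
    (F : Module.Basis (Fin (Module.finrank K (inverseSystem (Ann f) m))) K
      (inverseSystem (Ann f) m)) :
    HasExpectedOsculatingDim (fun j => (F j : MvPolynomial (Fin (n + 1)) K)) k ↔
      hess f α ≠ 0 := by
  have hF0 := exists_basis_inverseSystem_Ann_ne_zero hf hf0 F
  rw [hasExpectedOsculatingDim_iff_exists hm (fun j => (F j).2.1) hF0
    ((finrank_inverseSystem_Ann hf).trans_le (finrank_gradedPiece_le _ k))]
  constructor
  · rintro ⟨g, hg, hgen⟩
    obtain ⟨δ, hδ, hpow⟩ :=
      exists_forall_mem_ker_aeval_sup fun j => (F j : MvPolynomial (Fin (n + 1)) K)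
    obtain ⟨j, hj⟩ := hF0
    obtain ⟨P, hP⟩ := exists_eval_ne_zero (mul_ne_zero (mul_ne_zero hg hδ) hj)
    rw [map_mul, map_mul, mul_ne_zero_iff, mul_ne_zero_iff, eval_aeval] at hP
    obtain ⟨⟨hPg, hPδ⟩, hPj⟩ := hP
    have hfull := hgen (fun j => eval P (F j)) (fun h0 => hPj (congrFun h0 j))
      (fun p hp => by rw [RingHom.mem_ker, ← eval_aeval, RingHom.mem_ker.1 hp, map_zero]) hPg
    exact (hess_ne_zero_iff α).2 ⟨P, hfull.hessNondegenerateAt hf hkm (hpow P hPδ (k + 1))⟩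
  · intro hhess
    obtain ⟨g, hg, hlift⟩ := exists_forall_isPrime_exists_comap_eq
      (finiteType_aeval fun j => (F j : MvPolynomial (Fin (n + 1)) K)) hhess
    refine ⟨g, hg, fun v _ hker hvg => ?_⟩
    obtain ⟨q, hq, hqv, hhq⟩ := hlift _ (RingHom.ker_isPrime (eval v)) hker hvg
    exact (hessNondegenerateAt_of_hess_notMem hhq).hasFullOsculatingSpaceAt hf F hqv.ge

theorem forall_hess_ne_zero_iff {d : ℕ} (hf : f.IsHomogeneous d) (hf0 : f ≠ 0) {ι : ℕ → Type*}
    [∀ k, Fintype (ι k)] [∀ k, DecidableEq (ι k)]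
    (α : ∀ k, Module.Basis (ι k) K (gradedPiece (Ann f) k)) :
    (∀ k, 2 * k ≤ d → hess f (α k) ≠ 0) ↔ ∀ k, 0 < k → 2 * k < d → hess f (α k) ≠ 0 := by
  refine ⟨fun h k _ hk => h k hk.le, fun h k hk => ?_⟩
  obtain ⟨P, hP⟩ := exists_eval_ne_zero hf0
  rcases hk.eq_or_lt with rfl | hlt
  · refine (hess_ne_zero_iff (α k)).2 ⟨P, (hessNondegenerateAt_ker_eval_iff (e := 0) hf).2 ?_⟩
    simp
  rcases Nat.eq_zero_or_pos k with rfl | hpos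
  · exact (hess_ne_zero_iff (α 0)).2 ⟨P, hessNondegenerateAt_zero hP⟩
  · exact h k hpos hlt

end PolarVariety

end Apolar

end

theorem mainTheorem6_general {K : Type*} [Field K] [CharZero K] (n d : ℕ)
    (f : MvPolynomial (Fin (n + 1)) K) (hf : f.IsHomogeneous d) (hf0 : f ≠ 0)
    (α : ∀ k : ℕ, Module.Basis (Fin (Module.finrank K (Apolar.gradedPiece (Apolar.Ann f) k))) K
      (Apolar.gradedPiece (Apolar.Ann f) k))
    (F : ∀ k : ℕ, Module.Basis (Fin (Module.finrank K (Apolar.inverseSystem (Apolar.Ann f) k))) K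
      (Apolar.inverseSystem (Apolar.Ann f) k)) :
    List.TFAE
      [Apolar.HasSLP (Apolar.Ann f),
        ∀ k : ℕ, 2 * k ≤ d → Apolar.hess f (α k) ≠ 0,
        ∀ k : ℕ, 0 < k → 2 * k < d →
          Apolar.HasExpectedOsculatingDim
            (fun j => (F (d - k) j : MvPolynomial (Fin (n + 1)) K)) k] := by
  have polar (k : ℕ) (hk : 2 * k < d) : Apolar.HasExpectedOsculatingDim
      (fun j => (F (d - k) j : MvPolynomial (Fin (n + 1)) K)) k ↔ Apolar.hess f (α k) ≠ 0 :=
    Apolar.hasExpectedOsculatingDim_iff_hess_ne_zero (by rwa [Nat.add_sub_of_le (by omega)]) hf0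
      (by omega) (by omega) (α k) (F (d - k))
  tfae_have 1 ↔ 2 := Apolar.hasSLP_Ann_iff_forall_hess_ne_zero hf α
  tfae_have 2 ↔ 3 := (Apolar.forall_hess_ne_zero_iff hf hf0 α).trans <|
    forall₃_congr fun k _ hk => (polar k hk).symm
  tfae_finish

theorem mainTheorem6 {K : Type*} [Field K] [IsAlgClosed K] [CharZero K] (n d : ℕ)
    (f : MvPolynomial (Fin (n + 1)) K) (hf : f.IsHomogeneous d) (hf0 : f ≠ 0)
    (α : ∀ k : ℕ, Module.Basis (Fin (Module.finrank K (Apolar.gradedPiece (Apolar.Ann f) k))) K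
      (Apolar.gradedPiece (Apolar.Ann f) k))
    (F : ∀ k : ℕ, Module.Basis (Fin (Module.finrank K (Apolar.inverseSystem (Apolar.Ann f) k))) K
      (Apolar.inverseSystem (Apolar.Ann f) k)) :
    List.TFAE
      [Apolar.HasSLP (Apolar.Ann f),
        ∀ k : ℕ, 2 * k ≤ d → Apolar.hess f (α k) ≠ 0,
        ∀ k : ℕ, 0 < k → 2 * k < d →
          Apolar.HasExpectedOsculatingDim
            (fun j => (F (d - k) j : MvPolynomial (Fin (n + 1)) K)) k] :=
  mainTheorem6_general n d f hf hf0 α F
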